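/- **Setting.** A $3$-pair network $\mathcal N$ is a directed acyclic graph with three distinct sources $s_1,s_2,s_3$ of in-degree $0$ and three distinct sinks $t_1,t_2,t_3$ of out-degree $0$. It is *stable* if for every sink $t_m$ there is exactly one choice of three directed paths $P_{s_1,t_m},P_{s_2,t_m},P_{s_3,t_m}$ ($P_{s_i,t_m}$ from $s_i$ to $t_m$) that pairwise share no vertex other than $t_m$. (This holds in particular whenever for every sink there is exactly one choice of pairwise arc-disjoint such paths.) Fix two distinct sinks, called $t_1,t_2$, and write $r_i=P_{s_i,t_1}$ (red) and $g_i=P_{s_i,t_2}$ (green). $\mathcal N_{t_1,t_2}$ is the subnetwork consisting of the vertices and arcs of $r_1,r_2,r_3,g_1,g_2,g_3$. A *longest common segment* (l.c.s.) of two paths is a nonempty segment (possibly a single vertex) common to both that is not properly contained in another common segment. For $p\in\{r_1,r_2,r_3,g_1,g_2,g_3\}$ let $\ell(p)$ be the number of $\{r_i,g_j\}$-l.c.s.'s ($1\le i,j\le 3$) lying on $p$, and let $p(1)<p(2)<\dots<p(\ell(p))$ be these, in the order along $p$; here $a<b$ means that the last vertex of $a$ strictly precedes the first vertex of $b$ in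 the order of the acyclic graph. $\mathcal N_{t_1,t_2}$ is *non-degenerated* if there is exactly one pair $(i,l)$ with $i\ne l$ and $\ell(r_i)=\ell(g_l)=1$. **Theorem.** Let $\mathcal N$ be a stable $3$-pair network such that $\mathcal N_{t_1,t_2}$ is non-degenerated. Contract every $\{r_i,g_j\}$-l.c.s. of $\mathcal N_{t_1,t_2}$ to a single vertex and then suppress all vertices whose in-degree and out-degree are both $1$. The resulting network with its coloured arcs is isomorphic, up to relabelling the sources and possibly exchanging the two colours together with $t_1,t_2$, to one of the following five networks, where $X,Y,Z,W$ are distinct vertices and $i,j,l$ are the three source indices. In all of them $r_i=[s_i,t_1]$ and $g_l=[s_l,t_2]$, and * (1.1.1): $r_j=[s_j,X,t_1]$, $r_l=[s_l,Y,t_1]$, $g_i=[s_i,X,t_2]$, $g_j=[s_j,Y,t_2]$; * (1.1.2): $r_j=[s_j,X,Z,t_1]$, $r_l=[s_l,Y,t_1]$, $g_i=[s_i,X,t_2]$, $g_j=[s_j,Y,Z,t_2]$; * (1.2.1): $r_j=[s_j,X,t_1]$, $r_l=[s_l,Y,W,t_1]$, $g_i=[s_i,X,W,t_2]$, $g_j=[s_j,Y,t_2]$;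 * (1.2.2.1): $r_j=[s_j,X,t_1]$, $r_l=[s_l,W,Y,t_1]$, $g_i=[s_i,X,W,t_2]$, $g_j=[s_j,Y,t_2]$; * (1.2.2.2): $r_j=[s_j,X,Z,t_1]$, $r_l=[s_l,W,Y,t_1]$, $g_i=[s_i,X,W,t_2]$, $g_j=[s_j,Y,Z,t_2]$. Moreover, let $i,l$ be such that $\ell(r_i)=\ell(g_l)=1$, and let $j$ be distinct from both $i$ and $l$. Then: 1. $g_i(2)$ and $r_l(2)$ exist and $g_i(2)\ne r_l(2)$; 2. there is a unique $\{g_i,r_j\}$-l.c.s. and a unique $\{g_j,r_l\}$-l.c.s.; 3. one of the following holds, where each equality includes the existence of both sides: * a) $g_i(2)=r_j(2)$ and $g_j(2)=r_l(2)$ (type $1$); * b) $g_i(2)=r_j(2)$ and $g_j(2)=r_l(3)$ (type $2$); * c) $g_i(3)=r_j(2)$ and $g_j(2)=r_l(2)$ (type $2$). -/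

import Mathlib

/-- A `k`-pair network: a directed acyclic graph with `k` distinct sources of in-degree zero
and `k` distinct sinks of out-degree zero. -/
structure PairNetwork (k : ℕ) (V : Type*) where
  Arc : V → V → Prop
  acyclic : ∀ v, ¬ Relation.TransGen Arc v v
  s : Fin k → V
  t : Fin k → V
  s_injective : Function.Injective s
  t_injective : Function.Injective t
  not_arc_s : ∀ i v, ¬ Arc v (s i)
  not_arc_t : ∀ j v, ¬ Arc (t j) v

namespace PairNetwork

variable {k : ℕ} {V : Type*}

/-- A directed path from `u` to `v`, given by its list of vertices. -/
def IsPath (N : PairNetwork k V) (u v : V) (p : List V) : Prop :=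
  p.IsChain N.Arc ∧ p.head? = some u ∧ p.getLast? = some v

/-- `P` is a choice of edge-disjoint paths `P i` from `s i` to the sink `t j`. -/
def IsEdgeDisjointFamily (N : PairNetwork k V) (j : Fin k) (P : Fin k → List V) : Prop :=
  (∀ i, N.IsPath (N.s i) (N.t j) (P i)) ∧
    ∀ i i', i ≠ i' → ∀ u v, [u, v] <:+: P i → ¬ [u, v] <:+: P i'

/-- `P` is a choice of paths `P i` from `s i` to the sink `t j`, pairwise sharing no vertex
other than `t j`. -/
def IsFamily (N : PairNetwork k V) (j : Fin k) (P : Fin k → List V) : Prop :=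
  (∀ i, N.IsPath (N.s i) (N.t j) (P i)) ∧
    ∀ i i', i ≠ i' → ∀ v, v ∈ P i → v ∈ P i' → v = N.t j

/-- The network is stable: it is extra strongly reachable and for every sink the choice of the
paths is unique. By `stable_of_existsUnique_edgeDisjoint` below, this is implied by uniqueness
of the edge-disjoint choice. -/
def Stable (N : PairNetwork k V) : Prop :=
  ∀ j, ∃! P : Fin k → List V, N.IsFamily j P

end PairNetwork

section Segments

variable {V : Type*}

/-- `a` is a longest common segment of the paths `p` and `q`; a segment may consist of a single
vertex. -/
def IsLCS (p q a : List V) : Prop :=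
  a ≠ [] ∧ a <:+: p ∧ a <:+: q ∧ ∀ b, a <:+: b → b <:+: p → b <:+: q → b = a

/-- The longest common segments of a red path `r i` and a green path `g j` that lie on `p`. -/
def segmentsOn (r g : Fin 3 → List V) (p : List V) : Set (List V) :=
  {a | a <:+: p ∧ ∃ i j, IsLCS (r i) (g j) a}

/-- The number `ℓ(p)` of such segments. -/
noncomputable def numSegments (r g : Fin 3 → List V) (p : List V) : ℕ :=
  (segmentsOn r g p).ncard

/-- The subnetwork formed by the red paths `r` and the green paths `g` is non-degenerated. -/
def NonDegenerated (r g : Fin 3 → List V) : Prop :=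
  ∃! x : Fin 3 × Fin 3,
    x.1 ≠ x.2 ∧ numSegments r g (r x.1) = 1 ∧ numSegments r g (g x.2) = 1

/-- `a < b` for segments: the last vertex (head) of `a` strictly precedes the first vertex (tail)
of `b` in the order of the acyclic graph. -/
def PairNetwork.Before {k : ℕ} (N : PairNetwork k V) (a b : List V) : Prop :=
  ∃ u v, a.getLast? = some u ∧ b.head? = some v ∧ Relation.TransGen N.Arc u v

/-- `a = p(m)`: the segment `a` is the `m`-th one on `p` (counting from `1`). -/
def PairNetwork.IsNthSegment {k : ℕ} (N : PairNetwork k V) (r g : Fin 3 → List V)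
    (p : List V) (m : ℕ) (a : List V) : Prop :=
  a ∈ segmentsOn r g p ∧ {b ∈ segmentsOn r g p | N.Before b a}.ncard + 1 = m

/-- `p(m) = q(n)`: both segments exist and they coincide. -/
def PairNetwork.SameSegment {k : ℕ} (N : PairNetwork k V) (r g : Fin 3 → List V)
    (p : List V) (m : ℕ) (q : List V) (n : ℕ) : Prop :=
  ∃ a, N.IsNthSegment r g p m a ∧ N.IsNthSegment r g q n a

end Segments

/-- A directed graph whose arcs carry colours (`0` red, `1` green), with three labelled sources
and a sink for each colour. An arc may carry both colours. -/
structure ColoredNet (W : Type*) where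
  arc : Fin 2 → W → W → Prop
  src : Fin 3 → W → Prop
  snk : Fin 2 → W → Prop

namespace ColoredNet

variable {V W W' : Type*}

/-- The network formed by three red paths `r i` and three green paths `g i`, where `r i` and
`g i` start at source `i`. -/
def ofPaths (r g : Fin 3 → List V) : ColoredNet V where
  arc c u v := ∃ i, [u, v] <:+: ![r, g] c i
  src i v := (r i).head? = some v ∧ (g i).head? = some v
  snk c v := ∀ i, (![r, g] c i).getLast? = some v

/-- The vertices after contraction: the vertex set of a longest common segment, or a single
vertex of the paths that lies on no longest common segment. -/
def IsBlock (r g : Fin 3 → List V) (B : Set V) : Prop :=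
  (∃ i j a, IsLCS (r i) (g j) a ∧ B = {v | v ∈ a}) ∨
    ∃ v, (∃ i, v ∈ r i ∨ v ∈ g i) ∧ (∀ i j a, IsLCS (r i) (g j) a → v ∉ a) ∧ B = {v}

/-- The network formed by the paths, with each longest common segment contracted to a vertex. -/
def contract (r g : Fin 3 → List V) : ColoredNet {B : Set V // IsBlock r g B} where
  arc c B C := B ≠ C ∧ ∃ u ∈ B.1, ∃ v ∈ C.1, (ofPaths r g).arc c u v
  src i B := ∃ v ∈ B.1, (ofPaths r g).src i v
  snk c B := ∃ v ∈ B.1, (ofPaths r g).snk c v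

/-- In-degree and out-degree of `w` are both `1`. -/
def IsPassing (A : ColoredNet W) (w : W) : Prop :=
  (∃! x : Fin 2 × W, A.arc x.1 x.2 w) ∧ ∃! x : Fin 2 × W, A.arc x.1 w x.2

/-- Suppress all vertices whose in-degree and out-degree are both `1`: a path whose inner
vertices are all suppressed becomes an arc. -/
def suppress (A : ColoredNet W) : ColoredNet {w : W // ¬ A.IsPassing w} where
  arc c x y := ∃ l : List W, (∀ w ∈ l, A.IsPassing w) ∧
    (x.1 :: (l ++ [y.1])).IsChain (A.arc c)
  src i x := A.src i x.1
  snk c x := A.snk c x.1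

/-- Isomorphism of coloured networks, up to relabelling the sources and permuting the two
colours (together with their sinks). -/
def Isomorphic (A : ColoredNet W) (B : ColoredNet W') : Prop :=
  ∃ (e : W ≃ W') (σ : Equiv.Perm (Fin 3)) (τ : Equiv.Perm (Fin 2)),
    (∀ c u v, A.arc c u v ↔ B.arc (τ c) (e u) (e v)) ∧
    (∀ i u, A.src i u ↔ B.src (σ i) (e u)) ∧
    (∀ c u, A.snk c u ↔ B.snk (τ c) (e u))

/-! The five configurations. The sources are `0, 1, 2`, the sinks are `3` (red) and `4` (green),
and the vertices from `5` on are the remaining contracted segments. -/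

def config111 : ColoredNet (Fin 7) :=
  ofPaths ![[0, 3], [1, 5, 3], [2, 6, 3]] ![[0, 5, 4], [1, 6, 4], [2, 4]]

def config112 : ColoredNet (Fin 8) :=
  ofPaths ![[0, 3], [1, 5, 7, 3], [2, 6, 3]] ![[0, 5, 4], [1, 6, 7, 4], [2, 4]]

def config121 : ColoredNet (Fin 8) :=
  ofPaths ![[0, 3], [1, 5, 3], [2, 6, 7, 3]] ![[0, 5, 7, 4], [1, 6, 4], [2, 4]]

def config1221 : ColoredNet (Fin 8) :=
  ofPaths ![[0, 3], [1, 5, 3], [2, 7, 6, 3]] ![[0, 5, 7, 4], [1, 6, 4], [2, 4]]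

def config1222 : ColoredNet (Fin 9) :=
  ofPaths ![[0, 3], [1, 5, 8, 3], [2, 7, 6, 3]] ![[0, 5, 7, 4], [1, 6, 8, 4], [2, 4]]

end ColoredNet

namespace PairNetwork

variable {k : ℕ} {V : Type*}

/-- A directed walk in an acyclic graph repeats no vertex. -/
theorem nodup_of_isChain (N : PairNetwork k V) {p : List V} (h : p.IsChain N.Arc) :
    p.Nodup := by
  have h1 : p.IsChain (Relation.TransGen N.Arc) :=
    h.imp fun _ _ h => Relation.TransGen.single h
  have h2 := List.isChain_iff_pairwise.mp h1
  refine h2.imp ?_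
  rintro a b hab rfl
  exact N.acyclic _ hab

theorem IsFamily.isEdgeDisjointFamily {N : PairNetwork k V} {j : Fin k} {P : Fin k → List V}
    (h : N.IsFamily j P) : N.IsEdgeDisjointFamily j P := by
  refine ⟨h.1, fun i i' hi u v hu hu' => ?_⟩
  have hut : u = N.t j := h.2 i i' hi u (hu.subset (by simp)) (hu'.subset (by simp))
  have := (h.1 i).1.infix hu
  rw [List.isChain_pair, hut] at this
  exact N.not_arc_t _ _ this

theorem pair_infix_split {x y v : V} {l₁ l₂ : List V} (h : [x, y] <:+: l₁ ++ v :: l₂) :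
    [x, y] <:+: l₁ ++ [v] ∨ [x, y] <:+: v :: l₂ := by
  induction l₁ with
  | nil => exact Or.inr h
  | cons c l₁ ih =>
    rw [List.cons_append, List.infix_cons_iff] at h
    rcases h with h | h
    · left
      rw [List.cons_prefix_cons] at h
      obtain ⟨rfl, h⟩ := h
      refine List.IsPrefix.isInfix ?_
      rw [List.cons_append, List.cons_prefix_cons]
      refine ⟨rfl, ?_⟩
      cases l₁ with
      | nil => simpa using h
      | cons d l₁ => simpa using h
    · rcases ih h with h | h
      · exact Or.inl (List.infix_cons h)
      · exact Or.inr h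

theorem mem_of_pair_infix_cons {x y v : V} {l : List V} (h : [x, y] <:+: v :: l) : y ∈ l := by
  rw [List.infix_cons_iff] at h
  rcases h with h | h
  · rw [List.cons_prefix_cons] at h
    exact h.2.subset (by simp)
  · exact h.subset (by simp)

/-- If the edge-disjoint choice of paths is unique for every sink, the network is stable. -/
theorem stable_of_existsUnique_edgeDisjoint (N : PairNetwork k V)
    (h : ∀ j, ∃! P : Fin k → List V, N.IsEdgeDisjointFamily j P) : N.Stable := by
  intro j
  obtain ⟨P, hP, huniq⟩ := h j
  refine ⟨P, ⟨hP.1, ?_⟩, fun Q hQ => huniq Q hQ.isEdgeDisjointFamily⟩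
  intro a b hab v hva hvb
  by_contra hvt
  obtain ⟨A1, A2, hA⟩ := List.append_of_mem hva
  obtain ⟨B1, B2, hB⟩ := List.append_of_mem hvb
  have hAv : A1 ++ [v] <:+: P a := ⟨[], A2, by simp [hA]⟩
  have hvA : v :: A2 <:+: P a := ⟨A1, [], by simp [hA]⟩
  have hBv : B1 ++ [v] <:+: P b := ⟨[], B2, by simp [hB]⟩
  have hvB : v :: B2 <:+: P b := ⟨B1, [], by simp [hB]⟩
  have hpath : ∀ (c d : Fin k) (C1 C2 D1 D2 : List V), P c = C1 ++ v :: C2 →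
      P d = D1 ++ v :: D2 → N.IsPath (N.s c) (N.t j) (C1 ++ v :: D2) := by
    intro c d C1 C2 D1 D2 hc hd
    obtain ⟨c1, c2, -⟩ := hP.1 c
    obtain ⟨d1, -, d3⟩ := hP.1 d
    rw [hc] at c1 c2
    rw [hd] at d1 d3
    refine ⟨?_, ?_, ?_⟩
    · rw [List.isChain_split] at c1 d1 ⊢
      exact ⟨c1.1, d1.2⟩
    · cases C1 <;> simpa using c2
    · rw [List.getLast?_append_of_ne_nil _ (by simp)] at d3 ⊢
      exact d3
  have hnd : ∀ (c : Fin k) (C1 C2 : List V), P c = C1 ++ v :: C2 → ∀ x y,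
      [x, y] <:+: C1 ++ [v] → ¬ [x, y] <:+: v :: C2 := by
    intro c C1 C2 hc x y h1 h2
    have hn := N.nodup_of_isChain (hP.1 c).1
    have e : P c = (C1 ++ [v]) ++ C2 := by simp [hc]
    rw [e, List.nodup_append] at hn
    exact hn.2.2 y (h1.subset (by simp)) y (mem_of_pair_infix_cons h2) rfl
  let Q : Fin k → List V := fun i =>
    if i = a then A1 ++ v :: B2 else if i = b then B1 ++ v :: A2 else P i
  have hQa : Q a = A1 ++ v :: B2 := by simp [Q]
  have hQb : Q b = B1 ++ v :: A2 := by simp [Q, hab.symm]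
  have hQc : ∀ c, c ≠ a → c ≠ b → Q c = P c := fun c h1 h2 => by simp [Q, h1, h2]
  have eQa : ∀ {x y}, [x, y] <:+: Q a → [x, y] <:+: A1 ++ [v] ∨ [x, y] <:+: v :: B2 :=
    fun h => pair_infix_split (hQa ▸ h)
  have eQb : ∀ {x y}, [x, y] <:+: Q b → [x, y] <:+: B1 ++ [v] ∨ [x, y] <:+: v :: A2 :=
    fun h => pair_infix_split (hQb ▸ h)
  have hab' : ∀ {x y}, [x, y] <:+: P a → [x, y] <:+: P b → False :=
    fun h1 h2 => hP.2 a b hab _ _ h1 h2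
  have hdab : ∀ {x y}, [x, y] <:+: Q a → [x, y] <:+: Q b → False := by
    intro x y h1 h2
    rcases eQa h1 with h1 | h1 <;> rcases eQb h2 with h2 | h2
    · exact hab' (h1.trans hAv) (h2.trans hBv)
    · exact hnd a A1 A2 hA x y h1 h2
    · exact hnd b B1 B2 hB x y h2 h1
    · exact hab' (h2.trans hvA) (h1.trans hvB)
  have hda : ∀ c, c ≠ a → c ≠ b → ∀ {x y}, [x, y] <:+: Q a → [x, y] <:+: P c → False := by
    intro c h1 h2 x y h3 h4
    rcases eQa h3 with h3 | h3
    · exact hP.2 a c h1.symm x y (h3.trans hAv) h4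
    · exact hP.2 b c h2.symm x y (h3.trans hvB) h4
  have hdb : ∀ c, c ≠ a → c ≠ b → ∀ {x y}, [x, y] <:+: Q b → [x, y] <:+: P c → False := by
    intro c h1 h2 x y h3 h4
    rcases eQb h3 with h3 | h3
    · exact hP.2 b c h2.symm x y (h3.trans hBv) h4
    · exact hP.2 a c h1.symm x y (h3.trans hvA) h4
  have hQ : N.IsEdgeDisjointFamily j Q := by
    refine ⟨fun i => ?_, fun i i' hi x y h1 h2 => ?_⟩
    · by_cases ha : i = a
      · rw [ha, hQa]
        exact hpath a b A1 A2 B1 B2 hA hB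
      · by_cases hb : i = b
        · rw [hb, hQb]
          exact hpath b a B1 B2 A1 A2 hB hA
        · rw [hQc i ha hb]
          exact hP.1 i
    · by_cases ha : i = a
      · subst ha
        by_cases hb' : i' = b
        · subst hb'
          exact hdab h1 h2
        · exact hda i' hi.symm hb' h1 (hQc i' hi.symm hb' ▸ h2)
      · by_cases hb : i = b
        · subst hb
          by_cases ha' : i' = a
          · subst ha'
            exact hdab h2 h1
          · exact hdb i' ha' hi.symm h1 (hQc i' ha' hi.symm ▸ h2)
        · have h1' := hQc i ha hb ▸ h1
          by_cases ha' : i' = a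
          · subst ha'
            exact hda i ha hb h2 h1'
          · by_cases hb' : i' = b
            · subst hb'
              exact hdb i ha hb h2 h1'
            · exact hP.2 i i' hi x y h1' (hQc i' ha' hb' ▸ h2)
  have heq : Q a = P a := congrFun (huniq Q hQ) a
  rw [hQa, hA] at heq
  have h2 : B2 = A2 := by simpa using heq
  cases A2 with
  | nil =>
    have := (hP.1 a).2.2
    rw [hA] at this
    exact hvt (by simpa using this)
  | cons y A2 =>
    subst h2
    have hvy : [v, y] <:+: v :: y :: A2 := ⟨[], A2, rfl⟩
    exact hab' (hvy.trans hvA) (hvy.trans hvB)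

end PairNetwork

/-! Everything is read off from the order of the segments on the six paths. A vertex common to both
colours is never a sink, so it lies on exactly one path of each colour. Hence the maximal runs of
arcs used by both colours (`chunks`) that contain a common vertex are exactly the l.c.s.'s; each
lies on one red and one green path, and r_i and g_i begin with the same one, which contains s_i.

Uniqueness of the path families enters through two exchange arguments, valid for either assignment
of the colours. No jump (`eq_of_jump`): if two segments consecutive on a green path lay on one red
path, that red path could be rerouted along the green stretch between them. No crossing
(`not_crossing_vertices`): if green stretches lead from a to b and from a' to b', while a precedes
b' on one red path and a' precedes b on another, then both red paths can be rerouted, exchanging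
their ends. Together with acyclicity these are the axioms of `SegmentSystem`, and the classification
is pure combinatorics from there.

Let r_i and g_l consist of their first segments only. Then the second segment X of r_j must lie on
g_i, and the second segment Y of g_j on r_l. The core is `eq_of_mem_of_mem`: X is the only segment
shared by r_j and g_i, and, with the colours exchanged, Y the only one shared by g_j and r_l. All
others, apart from the starts, are shared by r_j and g_j or by g_i and r_l. No jump leaves at most
one segment Z of the first kind, behind X and Y, and at most one segment W of the second kind on
each side of X and of Y. Crossings and cycles exclude all but seven arrangements (`classification`),
two of which are mirror images of others under exchange of the colours.

Contraction turns chunks into vertices, and suppression removes precisely those that contain neither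
a common vertex nor a sink. So the paths of the resulting network are the lists of segments followed
by the sink (`suppress_arc`), which are matched with the five configurations. -/

/-! ### Consecutive elements of lists without repetition -/

namespace List

variable {α β : Type*}

theorem Nodup.append_cons_inj {l A B A' B' : List α} {u : α} (hl : l.Nodup)
    (h : l = A ++ u :: B) (h' : l = A' ++ u :: B') : A = A' ∧ B = B' := by
  subst h
  induction A generalizing A' with
  | nil =>
    cases A' with
    | nil => simpa using h'
    | cons x A' =>
      simp only [nil_append, cons_append, cons.injEq] at h'
      obtain ⟨rfl, rfl⟩ := h'
      simp at hl
  | cons x A ih =>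
    cases A' with
    | nil =>
      simp only [nil_append, cons_append, cons.injEq] at h'
      obtain ⟨rfl, rfl⟩ := h'
      simp at hl
    | cons y A' =>
      simp only [cons_append, cons.injEq] at h'
      obtain ⟨rfl, h'⟩ := h'
      have := ih (nodup_cons.1 hl).2 h'
      simpa using this

theorem Nodup.infix_merge {l a : List α} {x y : α} (hl : l.Nodup) (h : [x, y] <:+: l)
    (h' : y :: a <:+: l) : x :: y :: a <:+: l := by
  obtain ⟨A, B, rfl⟩ := h
  obtain ⟨A', B', h'⟩ := h'
  have h1 : A ++ [x, y] ++ B = (A ++ [x]) ++ y :: B := by simp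
  have h2 : A ++ [x, y] ++ B = A' ++ y :: (a ++ B') := by simp [← h']
  obtain ⟨-, rfl⟩ := hl.append_cons_inj h1 h2
  exact ⟨A, B', by simp⟩

theorem Nodup.succ_unique {l : List α} {u v w : α} (hl : l.Nodup) (h : [u, v] <:+: l)
    (h' : [u, w] <:+: l) : v = w := by
  obtain ⟨A, B, rfl⟩ := h
  obtain ⟨A', B', h'⟩ := h'
  have h1 : A ++ [u, v] ++ B = A ++ u :: v :: B := by simp
  have h2 : A ++ [u, v] ++ B = A' ++ u :: w :: B' := by simp [← h']
  simpa using (congrArg head? (hl.append_cons_inj h1 h2).2)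

theorem Nodup.pred_unique {l : List α} {u v w : α} (hl : l.Nodup) (h : [v, u] <:+: l)
    (h' : [w, u] <:+: l) : v = w := by
  obtain ⟨A, B, rfl⟩ := h
  obtain ⟨A', B', h'⟩ := h'
  have h1 : A ++ [v, u] ++ B = (A ++ [v]) ++ u :: B := by simp
  have h2 : A ++ [v, u] ++ B = (A' ++ [w]) ++ u :: B' := by simp [← h']
  simpa using (congrArg getLast? (hl.append_cons_inj h1 h2).1)

theorem Nodup.not_pair_infix_of_getLast? {l : List α} {u v : α} (hl : l.Nodup)
    (h : l.getLast? = some u) : ¬ [u, v] <:+: l := by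
  rintro ⟨A, B, rfl⟩
  rw [append_assoc, getLast?_append_of_ne_nil _ (by simp)] at h
  have h1 : u ∈ v :: B := by
    simp only [cons_append, nil_append, getLast?_cons_cons] at h
    exact mem_of_getLast? h
  simp [nodup_append] at hl
  simp at h1
  grind

theorem Nodup.not_pair_infix_of_head? {l : List α} {u v : α} (hl : l.Nodup)
    (h : l.head? = some v) : ¬ [u, v] <:+: l := by
  rintro ⟨A, B, rfl⟩
  cases A with
  | nil => simp at h; subst h; simp at hl
  | cons x A => simp at h; subst h; simp at hl

theorem exists_succ_of_mem {l : List α} {u v : α} (h : u ∈ l) (hv : l.getLast? = some v)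
    (huv : u ≠ v) : ∃ w, [u, w] <:+: l := by
  obtain ⟨A, B, rfl⟩ := append_of_mem h
  cases B with
  | nil => simp at hv; exact (huv hv).elim
  | cons w B => exact ⟨w, A, B, by simp⟩

theorem exists_pred_of_mem {l : List α} {u v : α} (h : u ∈ l) (hv : l.head? = some v)
    (huv : u ≠ v) : ∃ w, [w, u] <:+: l := by
  obtain ⟨A, B, rfl⟩ := append_of_mem h
  rcases eq_nil_or_concat A with rfl | ⟨A, w, rfl⟩
  · simp at hv; exact (huv hv).elim
  · exact ⟨w, A, B, by simp⟩

/-- Starting from one common element, a chain of a relation that is realised by consecutive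
elements of `l` is an infix of `l`. -/
theorem infix_of_isChain {l a : List α} {F : α → α → Prop} (hl : l.Nodup)
    (hF : ∀ u w, F u w → u ∈ l ∨ w ∈ l → [u, w] <:+: l) (ha : a.IsChain F) {v : α} (hva : v ∈ a)
    (hvl : v ∈ l) : a <:+: l := by
  induction a generalizing v with
  | nil => simp
  | cons x a ih =>
    cases a with
    | nil =>
      simp at hva
      subst hva
      exact (mem_iff_append.1 hvl).elim fun A ⟨B, h⟩ => ⟨A, B, by simp [h]⟩
    | cons y a =>
      rw [isChain_cons_cons] at ha
      rcases mem_cons.1 hva with rfl | hva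
      · have h1 := hF _ _ ha.1 (Or.inl hvl)
        exact hl.infix_merge h1 (ih ha.2 mem_cons_self (h1.subset (by simp)))
      · have h2 := ih ha.2 hva hvl
        exact hl.infix_merge (hF _ _ ha.1 (Or.inr (h2.subset mem_cons_self))) h2

theorem pair_infix_flatten {L : List (List α)} (hL : [] ∉ L) {u w : α}
    (h : [u, w] <:+: L.flatten) : (∃ a ∈ L, [u, w] <:+: a) ∨
      ∃ a b, [a, b] <:+: L ∧ a.getLast? = some u ∧ b.head? = some w := by
  induction L with
  | nil => simp at h
  | cons a L ih =>
    simp only [mem_cons, not_or] at hL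
    rw [flatten_cons, infix_append_iff] at h
    rcases h with h | h | ⟨t1, t2, h, h1, h2⟩
    · exact Or.inl ⟨a, by simp, h⟩
    · rcases ih hL.2 h with ⟨b, hb, h⟩ | ⟨b, c, hb, h⟩
      · exact Or.inl ⟨b, by simp [hb], h⟩
      · exact Or.inr ⟨b, c, infix_cons hb, h⟩
    -- `t1` is the part of the pair inside `a`; the pair straddles the boundary only if `t1` has
    -- exactly one element.
    · rcases t1 with _ | ⟨x, _ | ⟨y, t1⟩⟩
      · simp at h
        subst h
        rcases ih hL.2 h2.isInfix with ⟨b, hb, h⟩ | ⟨b, c, hb, h⟩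
        · exact Or.inl ⟨b, by simp [hb], h⟩
        · exact Or.inr ⟨b, c, infix_cons hb, h⟩
      · simp at h
        obtain ⟨rfl, rfl⟩ := h
        right
        cases L with
        | nil => simp at h2
        | cons b L =>
          refine ⟨a, b, ⟨[], L, by simp⟩, ?_, ?_⟩
          · obtain ⟨s, rfl⟩ := h1
            simp
          · cases b with
            | nil => simp at hL
            | cons z b =>
              obtain ⟨s, h2⟩ := h2
              simp at h2
              simp [h2.1]
      · simp at h
        obtain ⟨rfl, rfl, rfl, rfl⟩ := h
        exact Or.inl ⟨a, by simp, h1.isInfix⟩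

/-- Translates between neighbours after filtering and stretches of the full list. It serves both for
consecutive segments on a path and for the arcs that arise by suppression. -/
theorem pair_infix_filter {p : α → Bool} {L : List α} {a b : α} :
    [a, b] <:+: L.filter p ↔
      p a ∧ p b ∧ ∃ m, a :: (m ++ [b]) <:+: L ∧ ∀ x ∈ m, ¬ p x := by
  rw [infix_filter_iff]
  constructor
  · rintro ⟨l, hl, h⟩
    obtain ⟨l1, l2, rfl, h1, h2, h3⟩ := filter_eq_cons_iff.1 h.symm
    obtain ⟨l3, l4, rfl, h4, h5, h6⟩ := filter_eq_cons_iff.1 h3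
    refine ⟨h2, h5, l3, ?_, h4⟩
    refine IsInfix.trans ?_ hl
    exact ⟨l1, l4, by simp⟩
  · rintro ⟨ha, hb, m, h, hm⟩
    refine ⟨_, h, ?_⟩
    have : filter p m = [] := by simpa using hm
    simp [ha, hb, this]

theorem isChain_pair_infix (l : List α) : l.IsChain fun u w => [u, w] <:+: l := by
  rw [isChain_iff_forall_rel_of_append_cons_cons]
  intro a b l1 l2 h
  exact ⟨l1, l2, by simp [h]⟩

theorem pair_sublist_iff {l : List α} {x y : α} :
    [x, y] <+ l ↔ ∃ A B C, l = A ++ x :: (B ++ y :: C) := by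
  constructor
  · intro h
    obtain ⟨r1, r2, rfl, h1, h2⟩ := cons_sublist_iff.1 h
    rw [singleton_sublist] at h2
    obtain ⟨A, B, rfl⟩ := append_of_mem h1
    obtain ⟨C, D, rfl⟩ := append_of_mem h2
    exact ⟨A, B ++ C, D, by simp⟩
  · rintro ⟨A, B, C, rfl⟩
    refine Sublist.trans ?_ (sublist_append_right _ _)
    refine Sublist.cons_cons _ ?_
    refine Sublist.trans ?_ (sublist_append_right _ _)
    simp

theorem pair_sublist_or {l : List α} {x y : α} (hx : x ∈ l) (hy : y ∈ l) (h : x ≠ y) :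
    [x, y] <+ l ∨ [y, x] <+ l := by
  obtain ⟨A, B, rfl⟩ := append_of_mem hx
  simp only [mem_append, mem_cons, h.symm, false_or] at hy
  rcases hy with hy | hy <;> obtain ⟨C, D, rfl⟩ := append_of_mem hy
  · exact Or.inr (pair_sublist_iff.2 ⟨C, D, B, by simp⟩)
  · exact Or.inl (pair_sublist_iff.2 ⟨A, C, D, by simp⟩)

/-- Two stretches of `l` whose inner elements avoid `p`, but whose ends satisfy `p`, and which
share an inner element have the same end. -/
theorem Nodup.stretch_end_unique {l m m' : List α} {x x' y y' v : α} {p : α → Prop}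
    (hl : l.Nodup) (h : x :: (m ++ [y]) <:+: l) (h' : x' :: (m' ++ [y']) <:+: l)
    (hm : ∀ u ∈ m, ¬ p u) (hm' : ∀ u ∈ m', ¬ p u) (hy : p y) (hy' : p y') (hv : v ∈ m)
    (hv' : v ∈ m') : y = y' := by
  obtain ⟨A, B, h⟩ := h
  obtain ⟨A', B', h'⟩ := h'
  obtain ⟨C, D, rfl⟩ := append_of_mem hv
  obtain ⟨C', D', rfl⟩ := append_of_mem hv'
  have h1 : l = (A ++ x :: C) ++ v :: (D ++ y :: B) := by simp [← h]
  have h2 : l = (A' ++ x' :: C') ++ v :: (D' ++ y' :: B') := by simp [← h']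
  have h3 := (hl.append_cons_inj h1 h2).2
  rw [append_eq_append_iff] at h3
  -- `E` is the excess of the longer of `D`, `D'`. If it were nonempty, it would begin with `y` or
  -- `y'`, which satisfies `p`, inside a stretch that avoids `p`.
  rcases h3 with ⟨E, h3, h4⟩ | ⟨E, h3, h4⟩ <;> cases E <;> simp_all

theorem pair_infix_map {f : α → β} (hf : Function.Injective f) {l : List α} {x y : α} :
    [f x, f y] <:+: l.map f ↔ [x, y] <:+: l := by
  rw [infix_map_iff]
  constructor
  · rintro ⟨m, hm, h⟩
    have : [x, y].map f = m.map f := by simpa using h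
    rwa [hf.list_map this]
  · exact fun h => ⟨_, h, by simp⟩

end List

/-! ### Combinatorics of segment systems -/

/-- Two families of three lists of segments (one family for each colour), with the combinatorial
properties which the longest common segments inherit from uniqueness of the paths. -/
structure SegmentSystem {α : Type*} (R : Fin 2 → Fin 3 → List α) : Prop where
  nodup : ∀ c i, (R c i).Nodup
  index : ∀ {c i i' x}, x ∈ R c i → x ∈ R c i' → i = i'
  exists_mem : ∀ {c i x}, x ∈ R c i → ∀ d, ∃ j, x ∈ R d j
  head : ∀ i, ∃ s, ∀ c, ∃ L, R c i = s :: L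
  order : ∀ {c i d j x y}, [x, y].Sublist (R c i) → [y, x].Sublist (R d j) → False
  not_jump : ∀ {c d i j x y}, c ≠ d → [x, y] <:+: R d j → x ∈ R c i → y ∈ R c i → False
  not_crossing : ∀ {c d i i' j j' x y x' y'}, c ≠ d → [x, y] <:+: R d j → [x', y'] <:+: R d j' →
    [x, y'].Sublist (R c i) → [x', y].Sublist (R c i') → False

namespace SegmentSystem

variable {α : Type*} {R : Fin 2 → Fin 3 → List α} {c d : Fin 2} {i j l : Fin 3}

theorem fin_three_cases {i j l : Fin 3} (hij : i ≠ j) (hil : i ≠ l) (hjl : j ≠ l) (q : Fin 3) :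
    q = i ∨ q = j ∨ q = l := by
  omega

theorem exists_third : ∀ i l : Fin 3, ∃ j, j ≠ i ∧ j ≠ l := by
  decide

theorem mem_start (h : SegmentSystem R) {s : α} {L : List α} (hs : R c i = s :: L) (d : Fin 2) :
    ∃ L', R d i = s :: L' := by
  obtain ⟨t, ht⟩ := h.head i
  obtain ⟨L1, h1⟩ := ht c
  obtain ⟨L2, h2⟩ := ht d
  rw [hs] at h1
  obtain ⟨rfl, -⟩ := List.cons.inj h1
  exact ⟨L2, h2⟩

/-- The first segment is shared by `R c i` and `R d i`, so a shared second one would be a jump. -/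
theorem second_notMem (h : SegmentSystem R) (hcd : c ≠ d) {s x : α} {L : List α}
    (hs : R c i = s :: x :: L) : x ∉ R d i := by
  intro hx
  obtain ⟨L', hL⟩ := h.mem_start hs d
  exact h.not_jump hcd.symm (j := i) ⟨[], L, by simp [hs]⟩ (hL ▸ List.mem_cons_self) hx

/-- The only segment of `R d l` is the starting one, which belongs to `R c l` and therefore to no
other list of colour `c`. -/
theorem mem_third (h : SegmentSystem R) {x s : α} {L : List α} (hl : R d l = [s])
    (hil : i ≠ l) (hs : R c l = s :: L) (hx : x ∈ R c i) : x ∉ R d l := by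
  intro hx'
  rw [hl, List.mem_singleton] at hx'
  subst hx'
  exact hil (h.index hx (hs ▸ List.mem_cons_self))

/-- A second segment of `R d j` would have no place in colour `c`: not on `R c j`, by
`second_notMem`, and not on the other two lists, which consist only of their own starts. -/
theorem length_eq_one_of_ne (h : SegmentSystem R) (hcd : c ≠ d) (hij : i ≠ j) (hil : i ≠ l)
    (hjl : j ≠ l) (hi : (R c i).length = 1) (hl : (R c l).length = 1)
    (hl' : (R d l).length = 1) : (R d j).length = 1 := by
  obtain ⟨s, hs⟩ := h.head j
  obtain ⟨L, hL⟩ := hs d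
  rcases L with _ | ⟨y, L⟩
  · simp [hL]
  · exfalso
    have hy : y ∈ R d j := by simp [hL]
    obtain ⟨q, hq⟩ := h.exists_mem hy c
    have key : ∀ p, p ≠ j → (R c p).length = 1 → y ∉ R c p := by
      intro p hp h1 h2
      obtain ⟨t, ht⟩ := List.length_eq_one_iff.1 h1
      obtain ⟨L', hL'⟩ := h.mem_start ht d
      exact h.mem_third ht hp.symm hL' hy h2
    rcases fin_three_cases hij hil hjl q with rfl | rfl | rfl
    · exact key _ hij hi hq
    · exact h.second_notMem hcd.symm hL hq
    · exact key _ hjl.symm hl hq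

/-- A competitor `p ≠ l` contradicts uniqueness through the pair `(p, l)`. For `p = l`,
`length_eq_one_of_ne` makes the third list of colour `d` short as well, and its index `j` gives the
second pair `(i, j)`. -/
theorem eq_of_length_eq_one (h : SegmentSystem R) (hcd : c ≠ d) (hil : i ≠ l)
    (hi : (R c i).length = 1) (hl : (R d l).length = 1)
    (hu : ∀ p q, p ≠ q → (R c p).length = 1 → (R d q).length = 1 → p = i ∧ q = l) {p : Fin 3}
    (hp : (R c p).length = 1) : p = i := by
  by_contra hpi
  by_cases hpl : p = l
  · subst hpl
    obtain ⟨j, hji, hjp⟩ := exists_third i p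
    exact hjp (hu i j hji.symm hi
      (h.length_eq_one_of_ne hcd hji.symm hil hjp hi hp hl)).2
  · exact hpi (hu p l hpl hp hl).1

theorem pair_sublist_cons {s x : α} {L : List α} (hx : x ∈ s :: L) (h : x ≠ s) :
    [s, x].Sublist (s :: L) := by
  simpa [h] using hx

section

variable {si sj sl X Y : α} {A B C D : List α}

/-- Of the three lists of colour `d`, `R d j` is excluded by `second_notMem` and `R d l` because it
contains only its start. -/
theorem mem_of_second (h : SegmentSystem R) (hcd : c ≠ d) (hij : i ≠ j) (hil : i ≠ l)
    (hjl : j ≠ l) (hl : R d l = [sl]) (hl' : R c l = sl :: B) (hj : R c j = sj :: X :: A) :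
    X ∈ R d i := by
  have hX : X ∈ R c j := by simp [hj]
  obtain ⟨q, hq⟩ := h.exists_mem hX d
  rcases fin_three_cases hij hil hjl q with rfl | rfl | rfl
  · exact hq
  · exact (h.second_notMem hcd hj hq).elim
  · exact (h.mem_third hl hjl hl' hX hq).elim

/-- A further shared segment `X'` would have to follow `X` on both lists. Since `R d i` cannot jump
along `R c j`, it visits `R c l` at some `W` after `X` and then returns to `R c j`. The second
segment `Y` of `R d j` also lies on `R c l`, and each of the two orders of `Y` and `W` there
produces a crossing of stretches of `R d i` and `R d j`. -/
theorem eq_of_mem_of_mem (h : SegmentSystem R) (hcd : c ≠ d) (hij : i ≠ j) (hil : i ≠ l)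
    (hjl : j ≠ l) (hi : R c i = [si]) (hl : R d l = [sl]) (hj : R c j = sj :: X :: A)
    (hl' : R c l = sl :: B) (hi' : R d i = si :: C) (hj' : R d j = sj :: Y :: D) {X' : α}
    (h1 : X' ∈ R c j) (h2 : X' ∈ R d i) : X' = X := by
  by_contra hne
  have hXi : X ∈ R d i := h.mem_of_second hcd hij hil hjl hl hl' hj
  have hYl : Y ∈ R c l := h.mem_of_second hcd.symm hjl.symm hil.symm hij.symm hi hi' hj'
  have hXj : X ∈ R c j := by simp [hj]
  have hYj : Y ∈ R d j := by simp [hj']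
  have hnj := h.nodup c j
  have hndi := h.nodup d i
  have hne' : X' ≠ sj := by
    rintro rfl
    exact hij (h.index h2 (hj' ▸ List.mem_cons_self))
  have hXX : [X, X'].Sublist (R c j) := by
    rw [hj] at h1 ⊢
    exact (pair_sublist_cons (by simpa [hne'] using h1) hne).trans (List.sublist_cons_self _ _)
  have hXX' : [X, X'].Sublist (R d i) :=
    (List.pair_sublist_or hXi h2 (Ne.symm hne)).resolve_right fun h3 => h.order hXX h3
  have notStart : ∀ {x y}, [x, y] <:+: R d i → y ∉ R c i := by
    intro x y hxy hy
    rw [hi, List.mem_singleton] at hy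
    subst hy
    exact hndi.not_pair_infix_of_head? (by simp [hi']) hxy
  have toL : ∀ {x y}, [x, y] <:+: R d i → x ∈ R c j → y ∈ R c l := by
    intro x y hxy hx
    obtain ⟨q, hq⟩ := h.exists_mem (hxy.subset (List.mem_cons_of_mem _ List.mem_cons_self)) c
    rcases fin_three_cases hij hil hjl q with rfl | rfl | rfl
    · exact (notStart hxy hq).elim
    · exact (h.not_jump hcd hxy hx hq).elim
    · exact hq
  obtain ⟨P1, P2, P3, hP⟩ := List.pair_sublist_iff.1 hXX'
  -- Were `X` and `X'` neighbours on `R d i`, they would form a jump.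
  obtain ⟨W, P2, rfl⟩ : ∃ W P, P2 = W :: P := by
    cases P2 with
    | cons W P => exact ⟨W, P, rfl⟩
    | nil => exact (h.not_jump hcd (j := i) ⟨P1, P3, by simp [hP]⟩ hXj h1).elim
  have hXW : [X, W] <:+: R d i := ⟨P1, P2 ++ X' :: P3, by simp [hP]⟩
  have hWl : W ∈ R c l := toL hXW hXj
  -- The successor of `W` may be `X'` itself; only its membership in `R c j` matters.
  obtain ⟨W', hWW⟩ : ∃ W', [W, W'] <:+: R d i := by
    cases P2 with
    | cons W' P => exact ⟨W', P1 ++ [X], P ++ X' :: P3, by simp [hP]⟩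
    | nil => exact ⟨X', P1 ++ [X], P3, by simp [hP]⟩
  have hWj : W' ∈ R c j := by
    obtain ⟨q, hq⟩ := h.exists_mem (hWW.subset (List.mem_cons_of_mem _ List.mem_cons_self)) c
    rcases fin_three_cases hij hil hjl q with rfl | rfl | rfl
    · exact (notStart hWW hq).elim
    · exact hq
    · exact (h.not_jump hcd hWW hWl hq).elim
  have hsjW : W' ≠ sj := by
    rintro rfl
    exact hij (h.index (hWW.subset (by simp)) (hj' ▸ List.mem_cons_self))
  have hYW : Y ≠ W := by
    rintro rfl
    exact hij (h.index (hXW.subset (by simp)) hYj)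
  rcases List.pair_sublist_or hYl hWl hYW with h3 | h3
  -- `Y` precedes `W`. The predecessor `Z'` of `X'` on `R c j` lies on `R d j` and is neither `sj`
  -- nor `Y`, so `R d j` has a third segment `Y'`. It lies on `R c j`, and the stretches from `X` to
  -- `W` and from `Y` to `Y'` cross.
  · obtain ⟨Z', hZ⟩ : ∃ Z', [Z', X'] <:+: R c j :=
      List.exists_pred_of_mem h1 (v := sj) (by simp [hj]) hne'
    have hZc : Z' ∈ R c j := hZ.subset (by simp)
    have hZj : Z' ∈ R d j := by
      obtain ⟨q, hq⟩ := h.exists_mem hZc d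
      rcases fin_three_cases hij hil hjl q with rfl | rfl | rfl
      · exact (h.not_jump hcd.symm hZ hq h2).elim
      · exact hq
      · exact (h.mem_third hl hjl hl' hZc hq).elim
    have hZs : Z' ≠ sj := by
      rintro rfl
      exact hne (hnj.succ_unique hZ ⟨[], A, by simp [hj]⟩)
    have hZY : Z' ≠ Y := by
      rintro rfl
      exact hjl (h.index hZc hYl)
    rw [hj', List.mem_cons, List.mem_cons] at hZj
    obtain ⟨Y', D, rfl⟩ := List.exists_cons_of_ne_nil
      (List.ne_nil_of_mem ((hZj.resolve_left hZs).resolve_left hZY))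
    have hYY : [Y, Y'] <:+: R d j := ⟨[sj], D, by simp [hj']⟩
    have hY'd : Y' ∈ R d j := hYY.subset (by simp)
    have hYc : Y' ∈ R c j := by
      obtain ⟨q, hq⟩ := h.exists_mem hY'd c
      rcases fin_three_cases hij hil hjl q with rfl | rfl | rfl
      · exact (h.mem_third hi hij.symm hi' hY'd hq).elim
      · exact hq
      · exact (h.not_jump hcd hYY hYl hq).elim
    have hYs : Y' ≠ sj := by
      rintro rfl
      exact (h.nodup d j).not_pair_infix_of_head? (by simp [hj']) hYY
    have hYX : Y' ≠ X := by
      rintro rfl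
      exact hij (h.index hXi hY'd)
    refine h.not_crossing hcd hXW hYY ?_ h3 (i := j)
    rw [hj] at hYc ⊢
    exact (pair_sublist_cons (by simpa [hYs] using hYc) hYX).trans (List.sublist_cons_self _ _)
  -- `W` precedes `Y`: here the stretches from `sj` to `Y` and from `W` to `W'` cross.
  · refine h.not_crossing hcd (j := j) ⟨[], D, by simp [hj']⟩ hWW ?_ h3 (i := j) (x := sj)
    rw [hj] at hWj ⊢
    exact pair_sublist_cons hWj hsjW

/-- Two neighbours in `L` would be a jump along `R d j`. -/
theorem eq_nil_or_singleton (h : SegmentSystem R) (hcd : c ≠ d) {L : List α}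
    (hL : L <:+: R c i) (hL' : ∀ x ∈ L, x ∈ R d j) : L = [] ∨ ∃ x, L = [x] := by
  rcases L with _ | ⟨x, _ | ⟨y, L⟩⟩
  · simp
  · simp
  · refine (h.not_jump hcd.symm (List.IsInfix.trans ⟨[], L, rfl⟩ hL) (hL' x ?_) (hL' y ?_)).elim <;> simp

/-- The tail of `R c j` behind its second element. -/
theorem tail_eq (h : SegmentSystem R) (hcd : c ≠ d) (hij : i ≠ j) (hil : i ≠ l)
    (hjl : j ≠ l) (hi : R c i = [si]) (hl : R d l = [sl]) (hj : R c j = sj :: X :: A)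
    (hl' : R c l = sl :: B) (hi' : R d i = si :: C) (hj' : R d j = sj :: Y :: D) :
    (∀ x ∈ A, x ∈ D) ∧ (A = [] ∨ ∃ Z, A = [Z]) := by
  have hYl : Y ∈ R c l := h.mem_of_second hcd.symm hjl.symm hil.symm hij.symm hi hi' hj'
  have hA : ∀ x ∈ A, x ∈ R d j := by
    intro x hx
    have hxj : x ∈ R c j := by simp [hj, hx]
    obtain ⟨q, hq⟩ := h.exists_mem hxj d
    rcases fin_three_cases hij hil hjl q with rfl | rfl | rfl
    · have := h.eq_of_mem_of_mem hcd hij hil hjl hi hl hj hl' hi' hj' hxj hq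
      subst this
      have hn := h.nodup c j
      rw [hj] at hn
      simp [hx] at hn
    · exact hq
    · exact (h.mem_third hl hjl hl' hxj hq).elim
  refine ⟨fun x hx => ?_, h.eq_nil_or_singleton hcd (i := j) ⟨[sj, X], [], by simp [hj]⟩ hA⟩
  have h1 := hA x hx
  have hxj : x ∈ R c j := by simp [hj, hx]
  rw [hj', List.mem_cons, List.mem_cons] at h1
  rcases h1 with rfl | rfl | h1
  · have hn := h.nodup c j
    rw [hj] at hn
    simp [hx] at hn
  · exact (hjl (h.index hxj hYl)).elim
  · exact h1

/-- The decomposition of `R d i` at `X`. -/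
theorem split_eq (h : SegmentSystem R) (hcd : c ≠ d) (hij : i ≠ j) (hil : i ≠ l)
    (hjl : j ≠ l) (hi : R c i = [si]) (hl : R d l = [sl]) (hj : R c j = sj :: X :: A)
    (hl' : R c l = sl :: B) (hi' : R d i = si :: C) (hj' : R d j = sj :: Y :: D) :
    ∃ C1 C2, C = C1 ++ X :: C2 ∧ (C1 = [] ∨ ∃ W, C1 = [W]) ∧ (C2 = [] ∨ ∃ W, C2 = [W]) ∧
      (∀ x ∈ C1, x ∈ R c l) ∧ ∀ x ∈ C2, x ∈ R c l := by
  have hXi : X ∈ R d i := h.mem_of_second hcd hij hil hjl hl hl' hj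
  have hXC : X ∈ C := by
    rw [hi', List.mem_cons] at hXi
    rcases hXi with rfl | hXi
    · exact (hij (h.index (c := c) (hi ▸ List.mem_cons_self) (by simp [hj]))).elim
    · exact hXi
  obtain ⟨C1, C2, rfl⟩ := List.append_of_mem hXC
  have hn := h.nodup d i
  -- Nothing but `si` is available on `R c i`, and nothing but `X` on `R c j` by `eq_of_mem_of_mem`,
  -- so only `R c l` remains.
  have key : ∀ x ∈ R d i, x ≠ si → x ≠ X → x ∈ R c l := by
    intro x hx hxs hxX
    obtain ⟨q, hq⟩ := h.exists_mem hx c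
    rcases fin_three_cases hij hil hjl q with rfl | rfl | rfl
    · rw [hi, List.mem_singleton] at hq
      exact (hxs hq).elim
    · exact (hxX (h.eq_of_mem_of_mem hcd hij hil hjl hi hl hj hl' hi' hj' hq hx)).elim
    · exact hq
  rw [hi'] at key hn
  have h1 : ∀ x ∈ C1, x ∈ R c l := by
    intro x hx
    refine key x (by simp [hx]) ?_ ?_ <;> rintro rfl <;> simp [List.nodup_append, hx] at hn
    exact (hn.2.2.2 _ hx).1 rfl
  have h2 : ∀ x ∈ C2, x ∈ R c l := by
    intro x hx
    refine key x (by simp [hx]) ?_ ?_ <;> rintro rfl <;> simp [List.nodup_append, hx] at hn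
  exact ⟨C1, C2, rfl, h.eq_nil_or_singleton hcd.symm (i := i) ⟨[si], X :: C2, by simp [hi']⟩ h1,
    h.eq_nil_or_singleton hcd.symm (i := i) ⟨si :: C1 ++ [X], [], by simp [hi']⟩ h2, h1, h2⟩

end

theorem mem_sides {s y x : α} {B1 B2 : List α} (hx : x ∈ s :: (B1 ++ y :: B2)) (hs : x ≠ s)
    (hy : x ≠ y) : x ∈ B1 ++ B2 := by
  simpa [hs, hy] using hx

theorem mem_of_mem_sides {s y x : α} {B1 B2 : List α} (hx : x ∈ B1 ++ B2) :
    x ∈ s :: (B1 ++ y :: B2) := by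
  simp only [List.mem_append, List.mem_cons] at hx ⊢
  exact Or.inr (hx.imp_right Or.inr)

/-- Both sides carry the same at most two segments. Two of them would have to occur as `W, W'` on
one list and as `W', W` on the other, against `hord`, because equal first sides are excluded by
`hWW`. -/
theorem side_cases {C1 C2 B1 B2 : List α} (hC1 : C1 = [] ∨ ∃ W, C1 = [W])
    (hC2 : C2 = [] ∨ ∃ W, C2 = [W]) (hB1 : B1 = [] ∨ ∃ W, B1 = [W])
    (hB2 : B2 = [] ∨ ∃ W, B2 = [W]) (hCB : ∀ x ∈ C1 ++ C2, x ∈ B1 ++ B2)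
    (hBC : ∀ x ∈ B1 ++ B2, x ∈ C1 ++ C2) (hWW : ∀ W, C1 = [W] → B1 = [W] → False)
    (hord : ∀ W W', C1 = [W] → C2 = [W'] → B1 = [W'] → B2 = [W] → False)
    (hnC : (C1 ++ C2).Nodup) (hnB : (B1 ++ B2).Nodup) :
    (C1 = [] ∧ C2 = [] ∧ B1 = [] ∧ B2 = []) ∨
      (∃ W, C1 = [] ∧ C2 = [W] ∧ B1 = [] ∧ B2 = [W]) ∨
      (∃ W, C1 = [] ∧ C2 = [W] ∧ B1 = [W] ∧ B2 = []) ∨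
      ∃ W, C1 = [W] ∧ C2 = [] ∧ B1 = [] ∧ B2 = [W] := by
  rcases hC1 with rfl | ⟨W1, rfl⟩ <;> rcases hC2 with rfl | ⟨W2, rfl⟩ <;>
    rcases hB1 with rfl | ⟨W3, rfl⟩ <;> rcases hB2 with rfl | ⟨W4, rfl⟩ <;>
    simp at hCB hBC hnC hnB hWW hord ⊢ <;> grind

/-- The possible arrangements of the segments. -/
theorem classification (h : SegmentSystem R) (hcd : c ≠ d) (hij : i ≠ j) (hil : i ≠ l)
    (hjl : j ≠ l) (hi : ∀ p, (R c p).length = 1 ↔ p = i) (hl : ∀ q, (R d q).length = 1 ↔ q = l) :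
    ∃ si sj sl X Y, R c i = [si] ∧ R d l = [sl] ∧
      ((R c j = [sj, X] ∧ R c l = [sl, Y] ∧ R d i = [si, X] ∧ R d j = [sj, Y]) ∨
      (∃ Z, R c j = [sj, X, Z] ∧ R c l = [sl, Y] ∧ R d i = [si, X] ∧ R d j = [sj, Y, Z]) ∨
      (∃ W, R c j = [sj, X] ∧ R c l = [sl, Y, W] ∧ R d i = [si, X, W] ∧ R d j = [sj, Y]) ∨
      (∃ W, R c j = [sj, X] ∧ R c l = [sl, W, Y] ∧ R d i = [si, X, W] ∧ R d j = [sj, Y]) ∨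
      (∃ W, R c j = [sj, X] ∧ R c l = [sl, Y, W] ∧ R d i = [si, W, X] ∧ R d j = [sj, Y]) ∨
      (∃ Z W, R c j = [sj, X, Z] ∧ R c l = [sl, W, Y] ∧ R d i = [si, X, W] ∧
        R d j = [sj, Y, Z]) ∨
      (∃ Z W, R c j = [sj, X, Z] ∧ R c l = [sl, Y, W] ∧ R d i = [si, W, X] ∧
        R d j = [sj, Y, Z])) := by
  obtain ⟨si, hsi⟩ := List.length_eq_one_iff.1 ((hi i).2 rfl)
  obtain ⟨sl, hsl⟩ := List.length_eq_one_iff.1 ((hl l).2 rfl)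
  obtain ⟨C, hC⟩ := h.mem_start hsi d
  obtain ⟨B, hB⟩ := h.mem_start hsl c
  obtain ⟨sj, hsj⟩ := h.head j
  obtain ⟨A, hA⟩ := hsj c
  obtain ⟨D, hD⟩ := hsj d
  rcases A with _ | ⟨X, A⟩
  · exact (hij ((hi j).1 (by simp [hA])).symm).elim
  rcases D with _ | ⟨Y, D⟩
  · exact (hjl ((hl j).1 (by simp [hD]))).elim
  have hXi : X ∈ R d i := h.mem_of_second hcd hij hil hjl hsl hB hA
  have hYl : Y ∈ R c l := h.mem_of_second hcd.symm hjl.symm hil.symm hij.symm hsi hC hD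
  refine ⟨si, sj, sl, X, Y, hsi, hsl, ?_⟩
  -- `tail_eq` in both colour roles: each tail has at most one element and is contained in the
  -- other.
  have hAD : (A = [] ∧ D = []) ∨ ∃ Z, A = [Z] ∧ D = [Z] := by
    obtain ⟨h1, h2⟩ := h.tail_eq hcd hij hil hjl hsi hsl hA hB hC hD
    obtain ⟨h3, h4⟩ := h.tail_eq hcd.symm hjl.symm hil.symm hij.symm hsl hsi hD hC hB hA
    rcases h2 with rfl | ⟨Z, rfl⟩ <;> rcases h4 with rfl | ⟨Z', rfl⟩ <;> simp_all
  obtain ⟨C1, C2, rfl, hC1, hC2, hC1', hC2'⟩ :=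
    h.split_eq hcd hij hil hjl hsi hsl hA hB hC hD
  obtain ⟨B1, B2, rfl, hB1, hB2, hB1', hB2'⟩ :=
    h.split_eq hcd.symm hjl.symm hil.symm hij.symm hsl hsi hD hC hB hA
  have hnC := h.nodup d i
  have hnB := h.nodup c l
  have hXsi : X ≠ si := by rintro rfl; simp [hC] at hnC
  have hYsl : Y ≠ sl := by rintro rfl; simp [hB] at hnB
  have hXl : X ∉ R c l := fun hx => hjl (h.index (by simp [hA]) hx)
  have hYi : Y ∉ R d i := fun hx => hij (h.index hx (by simp [hD]))
  have hsli : sl ∉ R d i := fun hx => hil (h.index hx (by simp [hsl]))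
  have hsil : si ∉ R c l := fun hx => hil (h.index (by simp [hsi]) hx)
  have hCB : ∀ x ∈ C1 ++ C2, x ∈ B1 ++ B2 := by
    intro x hx
    have hx1 : x ∈ R c l := (List.mem_append.1 hx).elim (hC1' x) (hC2' x)
    have hx2 : x ∈ R d i := hC ▸ mem_of_mem_sides hx
    exact mem_sides (hB ▸ hx1) (ne_of_mem_of_not_mem hx2 hsli) (ne_of_mem_of_not_mem hx2 hYi)
  have hBC : ∀ x ∈ B1 ++ B2, x ∈ C1 ++ C2 := by
    intro x hx
    have hx1 : x ∈ R d i := (List.mem_append.1 hx).elim (hB1' x) (hB2' x)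
    have hx2 : x ∈ R c l := hB ▸ mem_of_mem_sides hx
    exact mem_sides (hC ▸ hx1) (ne_of_mem_of_not_mem hx2 hsil) (ne_of_mem_of_not_mem hx2 hXl)
  -- Crossing of the stretches from `sj` to `Y` and from `W` to `X`.
  have hWW : ∀ W, C1 = [W] → B1 = [W] → False := by
    rintro W rfl rfl
    refine h.not_crossing hcd (i := j) (i' := l) (j := j) (j' := i) (x := sj) (y := Y) (x' := W) (y' := X)
      ⟨[], D, by simp [hD]⟩ ⟨[si], C2, by simp [hC]⟩ ?_ ?_
    · simp [hA]
    · rw [hB]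
      exact List.Sublist.cons _ (by simp)
  -- Crossing of the stretches from `X` to `W` and from `Y` to `Z`. This removes one of the eight
  -- combinations of the four side cases with the presence of `Z`.
  have hWZ : ∀ W Z, A = [Z] → D = [Z] → C1 = [] → C2 = [W] → B1 = [] → B2 = [W] → False := by
    rintro W Z rfl rfl rfl rfl rfl rfl
    refine h.not_crossing hcd (i := j) (i' := l) (j := i) (j' := j) (x := X) (y := W) (x' := Y) (y' := Z)
      ⟨[si], [], by simp [hC]⟩ ⟨[sj], [], by simp [hD]⟩ ?_ ?_
    · rw [hA]
      exact List.sublist_cons_self _ _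
    · rw [hB]
      exact List.Sublist.cons _ (by simp)
  have hord : ∀ W W', C1 = [W] → C2 = [W'] → B1 = [W'] → B2 = [W] → False := by
    rintro W W' rfl rfl rfl rfl
    refine h.order (c := d) (i := i) (d := c) (j := l) (x := W) (y := W') ?_ ?_
    · rw [hC]
      exact List.Sublist.cons _ (by simp)
    · rw [hB]
      exact List.Sublist.cons _ (by simp)
  have hnC' : (C1 ++ C2).Nodup := by
    rw [hC] at hnC
    refine hnC.sublist (List.Sublist.cons _ ?_)
    simp
  have hnB' : (B1 ++ B2).Nodup := by
    rw [hB] at hnB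
    refine hnB.sublist (List.Sublist.cons _ ?_)
    simp
  rw [hA, hB, hC, hD]
  rcases side_cases hC1 hC2 hB1 hB2 hCB hBC hWW hord hnC' hnB' with
    ⟨rfl, rfl, rfl, rfl⟩ | ⟨W, rfl, rfl, rfl, rfl⟩ | ⟨W, rfl, rfl, rfl, rfl⟩ |
    ⟨W, rfl, rfl, rfl, rfl⟩ <;> rcases hAD with ⟨rfl, rfl⟩ | ⟨Z, rfl, rfl⟩
  · exact Or.inl ⟨rfl, rfl, rfl, rfl⟩
  · exact Or.inr (Or.inl ⟨Z, rfl, rfl, rfl, rfl⟩)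
  · exact Or.inr (Or.inr (Or.inl ⟨W, rfl, rfl, rfl, rfl⟩))
  · exact (hWZ W Z rfl rfl rfl rfl rfl rfl).elim
  · exact Or.inr (Or.inr (Or.inr (Or.inl ⟨W, rfl, rfl, rfl, rfl⟩)))
  · exact Or.inr (Or.inr (Or.inr (Or.inr (Or.inr (Or.inl ⟨Z, W, rfl, rfl, rfl, rfl⟩)))))
  · exact Or.inr (Or.inr (Or.inr (Or.inr (Or.inl ⟨W, rfl, rfl, rfl, rfl⟩))))
  · exact Or.inr (Or.inr (Or.inr (Or.inr (Or.inr (Or.inr ⟨Z, W, rfl, rfl, rfl, rfl⟩)))))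

end SegmentSystem

/-! ### Splicing paths, and the pair of path families -/

namespace PairNetwork

variable {k : ℕ} {V : Type*} {N : PairNetwork k V}

theorem isPath_splice {s s' t t' x y : V} {A A' B C m : List V}
    (h : N.IsPath s t (A ++ x :: B)) (h' : N.IsPath s' t' (A' ++ y :: C))
    (hm : (x :: (m ++ [y])).IsChain N.Arc) : N.IsPath s t' (A ++ x :: (m ++ y :: C)) := by
  obtain ⟨h1, h2, -⟩ := h
  obtain ⟨h3, -, h4⟩ := h'
  refine ⟨?_, ?_, ?_⟩
  · rw [List.isChain_split] at h1 h3 ⊢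
    refine ⟨h1.1, ?_⟩
    rw [← List.cons_append, List.isChain_split]
    exact ⟨hm, h3.2⟩
  · cases A <;> simpa using h2
  · rw [List.getLast?_append_of_ne_nil _ (by simp)] at h4
    rw [← List.cons_append, ← List.append_assoc, List.getLast?_append_of_ne_nil _ (by simp)]
    exact h4

end PairNetwork

/-- Three red paths `P 0` and three green paths `P 1` to two distinct sinks, each of them being
the only family of paths that are disjoint up to their sink. -/
structure TwoSinkPaths {V : Type*} (N : PairNetwork 3 V) (T : Fin 2 → Fin 3)
    (P : Fin 2 → Fin 3 → List V) : Prop where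
  inj : Function.Injective T
  fam : ∀ c, N.IsFamily (T c) (P c)
  uniq : ∀ c Q, N.IsFamily (T c) Q → Q = P c

section Defs

variable {V : Type*} (P : Fin 2 → Fin 3 → List V)

/-- An arc lying on paths of both colours. -/
def CommonArc (u v : V) : Prop := ∀ c, ∃ i, [u, v] <:+: P c i

/-- A vertex lying on paths of both colours. -/
def Common (v : V) : Prop := ∀ c, ∃ i, v ∈ P c i

open Classical in
/-- The path `p`, split into maximal runs of arcs that lie on paths of both colours. -/
noncomputable def chunks (p : List V) : List (List V) :=
  p.splitBy fun u v => decide (CommonArc P u v)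

/-- The vertex list `a` contains a common vertex. -/
def Meets (a : List V) : Prop := ∃ v ∈ a, Common P v

open Classical in
/-- The longest common segments on the `i`-th path of colour `c`, in their order. -/
noncomputable def segs (c : Fin 2) (i : Fin 3) : List (List V) :=
  (chunks P (P c i)).filter fun a => decide (Meets P a)

end Defs

/-! ### Maximal runs of common arcs -/

section Chunks

variable {V : Type*} {P : Fin 2 → Fin 3 → List V} {p a b : List V} {u v w : V}

@[simp]
theorem flatten_chunks (p : List V) : (chunks P p).flatten = p :=
  List.flatten_splitBy _ _

theorem ne_nil_of_mem_chunks (h : a ∈ chunks P p) : a ≠ [] :=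
  List.ne_nil_of_mem_splitBy h

theorem infix_of_mem_chunks (h : a ∈ chunks P p) : a <:+: p := by
  simpa using List.infix_of_mem_flatten h

theorem isChain_of_mem_chunks (h : a ∈ chunks P p) : a.IsChain (CommonArc P) := by
  simpa using List.isChain_of_mem_splitBy h

theorem not_commonArc_of_infix_chunks (h : [a, b] <:+: chunks P p) (ha : a.getLast? = some u)
    (hb : b.head? = some v) : ¬ CommonArc P u v := by
  have := (List.isChain_getLast_head_splitBy _ _).infix h
  simp only [List.isChain_cons_cons, List.isChain_singleton, and_true] at this
  obtain ⟨h1, h2, h3⟩ := this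
  rw [List.getLast?_eq_some_getLast h1, Option.some_inj] at ha
  rw [List.head?_eq_some_head h2, Option.some_inj] at hb
  simpa [ha, hb] using h3

theorem exists_mem_chunks (h : v ∈ p) : ∃ a ∈ chunks P p, v ∈ a := by
  rw [← flatten_chunks (P := P) p] at h
  exact List.mem_flatten.1 h

theorem pairwise_disjoint_chunks (hp : p.Nodup) : (chunks P p).Pairwise List.Disjoint := by
  rw [← flatten_chunks (P := P) p] at hp
  exact (List.nodup_flatten.1 hp).2

theorem eq_of_mem_chunks (hp : p.Nodup) (ha : a ∈ chunks P p) (hb : b ∈ chunks P p) (hva : v ∈ a)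
    (hvb : v ∈ b) : a = b := by
  by_contra hab
  have : Std.Symm (List.Disjoint (α := V)) := ⟨fun _ _ h => h.symm⟩
  exact (pairwise_disjoint_chunks hp).forall ha hb hab hva hvb

theorem nodup_chunks (hp : p.Nodup) : (chunks P p).Nodup := by
  refine (List.pairwise_iff_forall_sublist (R := (· ≠ ·))).2 ?_
  intro a b h hab
  subst hab
  obtain ⟨v, hv⟩ := List.exists_mem_of_ne_nil _ (ne_nil_of_mem_chunks (h.subset List.mem_cons_self))
  exact List.pairwise_iff_forall_sublist.1 (pairwise_disjoint_chunks hp) h hv hv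

/-- Neighbours of `p` in different chunks do not form a common arc, so a run of common arcs cannot
leave a chunk that it meets. -/
theorem infix_chunk_of_isChain (hp : p.Nodup) (ha : a ∈ chunks P p) (hb : b <:+: p)
    (hb' : b.IsChain (CommonArc P)) (hva : v ∈ a) (hvb : v ∈ b) : b <:+: a := by
  refine List.infix_of_isChain (F := fun u w => CommonArc P u w ∧ [u, w] <:+: p)
    (hp.sublist (infix_of_mem_chunks ha).sublist) ?_ ?_ hvb hva
  · rintro x y ⟨h1, h2⟩ h3
    rw [← flatten_chunks (P := P) p] at h2
    rcases List.pair_infix_flatten (fun h => ne_nil_of_mem_chunks h rfl) h2 with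
      ⟨e, he, h⟩ | ⟨e, f, h, hx, hy⟩
    · have : e = a := by
        rcases h3 with h3 | h3
        · exact eq_of_mem_chunks hp he ha (h.subset (by simp)) h3
        · exact eq_of_mem_chunks hp he ha (h.subset (by simp)) h3
      exact this ▸ h
    · exact (not_commonArc_of_infix_chunks h hx hy h1).elim
  · rw [List.isChain_iff_forall_rel_of_append_cons_cons] at hb' ⊢
    rintro x y l1 l2 h
    exact ⟨hb' h, List.IsInfix.trans ⟨l1, l2, by simp [h]⟩ hb⟩

theorem mem_segs {c : Fin 2} {i : Fin 3} : a ∈ segs P c i ↔ a ∈ chunks P (P c i) ∧ Meets P a := by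
  simp [segs]

theorem infix_flatten {α : Type*} {L L' : List (List α)} (h : L' <:+: L) :
    L'.flatten <:+: L.flatten := by
  obtain ⟨A, B, rfl⟩ := h
  exact ⟨A.flatten, B.flatten, by simp⟩

/-- Between two consecutive segments of a path, the path has no common vertices. -/
theorem exists_jump {c : Fin 2} {i : Fin 3} (h : [a, b] <:+: segs P c i) :
    ∃ x y m, a.getLast? = some x ∧ b.head? = some y ∧ x :: (m ++ [y]) <:+: P c i ∧
      (∀ u ∈ m, ¬ Common P u) ∧ ¬ (m = [] ∧ CommonArc P x y) := by
  classical
  obtain ⟨ha, hb, m, h, hm⟩ := List.pair_infix_filter.1 h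
  have ha' := ne_nil_of_mem_chunks (h.subset List.mem_cons_self)
  have hb' := ne_nil_of_mem_chunks (h.subset (List.mem_cons_of_mem _ (by simp)) : b ∈ _)
  refine ⟨a.getLast ha', b.head hb', m.flatten, List.getLast?_eq_some_getLast _,
    List.head?_eq_some_head _, ?_, ?_, ?_⟩
  · have h1 := infix_flatten h
    rw [flatten_chunks] at h1
    refine List.IsInfix.trans ⟨a.dropLast, b.tail, ?_⟩ h1
    conv_rhs => rw [List.flatten_cons, ← List.dropLast_append_getLast ha', List.flatten_append,
      List.flatten_singleton, ← List.cons_head_tail hb']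
    simp
  · intro u hu hc
    obtain ⟨e, he, hu⟩ := List.mem_flatten.1 hu
    exact hm e he (by simpa using ⟨u, hu, hc⟩)
  · rintro ⟨h1, h2⟩
    cases m with
    | nil =>
      exact not_commonArc_of_infix_chunks h (List.getLast?_eq_some_getLast _)
        (List.head?_eq_some_head _) h2
    | cons e m =>
      refine ne_nil_of_mem_chunks (h.subset (by simp) : e ∈ _) ?_
      simp at h1
      exact h1.1

end Chunks

/-! ### Chunks as longest common segments, and the exchange arguments -/

namespace TwoSinkPaths

variable {V : Type*} {N : PairNetwork 3 V} {T : Fin 2 → Fin 3} {P : Fin 2 → Fin 3 → List V}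
  {c d : Fin 2} {i j i' j' : Fin 3} {a b : List V} {u v w x y : V}

theorem path_nodup (h : TwoSinkPaths N T P) (c : Fin 2) (i : Fin 3) : (P c i).Nodup :=
  N.nodup_of_isChain ((h.fam c).1 i).1

theorem index_eq (h : TwoSinkPaths N T P) (hv : v ∈ P c i) (hv' : v ∈ P c i')
    (hne : v ≠ N.t (T c)) : i = i' := by
  by_contra hi
  exact hne ((h.fam c).2 i i' hi v hv hv')

/-- A sink has out-degree zero, so it can only be the last vertex of a path, but the paths of the
other colour end in another sink. -/
theorem sink_notMem (h : TwoSinkPaths N T P) (hcd : c ≠ d) : N.t (T c) ∉ P d i := by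
  intro hv
  by_cases hne : N.t (T c) = N.t (T d)
  · exact hcd (h.inj (N.t_injective hne))
  · obtain ⟨w, hw⟩ := List.exists_succ_of_mem hv ((h.fam d).1 i).2.2 hne
    have := ((h.fam d).1 i).1.infix hw
    rw [List.isChain_pair] at this
    exact N.not_arc_t _ _ this

theorem exists_ne (c : Fin 2) : ∃ d, c ≠ d := by
  revert c; decide

theorem eq_or_eq_of_ne (hcd : c ≠ d) (e : Fin 2) : e = c ∨ e = d := by
  omega

theorem Common.ne_sink (h : TwoSinkPaths N T P) (hv : Common P v) (c : Fin 2) :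
    v ≠ N.t (T c) := by
  rintro rfl
  obtain ⟨d, hd⟩ := exists_ne c
  obtain ⟨i, hi⟩ := hv d
  exact h.sink_notMem hd hi

theorem common_of_mem (hcd : c ≠ d) (hv : v ∈ P c i) (hv' : v ∈ P d j) : Common P v := by
  intro e
  rcases eq_or_eq_of_ne hcd e with rfl | rfl
  exacts [⟨i, hv⟩, ⟨j, hv'⟩]

theorem CommonArc.left (h : CommonArc P u v) : Common P u := fun c => by
  obtain ⟨i, hi⟩ := h c
  exact ⟨i, hi.subset (by simp)⟩

theorem CommonArc.right (h : CommonArc P u v) : Common P v := fun c => by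
  obtain ⟨i, hi⟩ := h c
  exact ⟨i, hi.subset (by simp)⟩

/-- The ends of a common arc are not sinks, so each determines the path of colour `c` through it. -/
theorem CommonArc.infix (h : TwoSinkPaths N T P) (ha : CommonArc P u v)
    (hm : u ∈ P c i ∨ v ∈ P c i) : [u, v] <:+: P c i := by
  obtain ⟨i', hi'⟩ := ha c
  have : i' = i := by
    rcases hm with hm | hm
    · exact h.index_eq (hi'.subset (by simp)) hm (Common.ne_sink h (CommonArc.left ha) c)
    · exact h.index_eq (hi'.subset (by simp)) hm (Common.ne_sink h (CommonArc.right ha) c)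
  exact this ▸ hi'

theorem infix_of_isChain_of_mem (h : TwoSinkPaths N T P) (ha : a.IsChain (CommonArc P))
    (hva : v ∈ a) (hv : v ∈ P c i) : a <:+: P c i :=
  List.infix_of_isChain (h.path_nodup c i) (fun _ _ h1 h2 => CommonArc.infix h h1 h2) ha hva hv

/-- By `CommonArc.infix` a run of common arcs stays on every path it meets. Splitting by common arcs
without regard to indices therefore produces segments common to one fixed pair of paths, and these
are maximal. -/
theorem isLCS_of_mem_chunks (h : TwoSinkPaths N T P) (hcd : c ≠ d)
    (ha : a ∈ chunks P (P c i)) (hva : v ∈ a) (hv : v ∈ P d j) : IsLCS (P c i) (P d j) a := by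
  refine ⟨ne_nil_of_mem_chunks ha, infix_of_mem_chunks ha,
    h.infix_of_isChain_of_mem (isChain_of_mem_chunks ha) hva hv, fun b hab hb hb' => ?_⟩
  have hbc : b.IsChain (CommonArc P) := by
    refine (List.isChain_pair_infix b).imp fun x y hxy e => ?_
    rcases eq_or_eq_of_ne hcd e with rfl | rfl
    exacts [⟨i, hxy.trans hb⟩, ⟨j, hxy.trans hb'⟩]
  have := infix_chunk_of_isChain (h.path_nodup c i) ha hb hbc hva (hab.subset hva)
  exact this.sublist.antisymm hab.sublist

theorem mem_chunks_of_isLCS (h : TwoSinkPaths N T P) (hcd : c ≠ d)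
    (ha : IsLCS (P c i) (P d j) a) : a ∈ chunks P (P c i) := by
  obtain ⟨h1, h2, h3, h4⟩ := ha
  obtain ⟨v, hv⟩ := List.exists_mem_of_ne_nil _ h1
  obtain ⟨b, hb, hvb⟩ := exists_mem_chunks (P := P) (h2.subset hv)
  have hl := h.isLCS_of_mem_chunks hcd hb hvb (h3.subset hv)
  have hbc : a.IsChain (CommonArc P) := by
    refine (List.isChain_pair_infix a).imp fun x y hxy e => ?_
    rcases eq_or_eq_of_ne hcd e with rfl | rfl
    exacts [⟨i, hxy.trans h2⟩, ⟨j, hxy.trans h3⟩]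
  have := infix_chunk_of_isChain (h.path_nodup c i) hb h2 hbc hvb hv
  exact h4 b this hl.2.1 hl.2.2.1 ▸ hb

theorem common_of_mem_segs (h : TwoSinkPaths N T P) (ha : a ∈ segs P c i) (hv : v ∈ a) :
    Common P v := by
  obtain ⟨h1, w, hw, hc⟩ := mem_segs.1 ha
  intro e
  obtain ⟨j, hj⟩ := hc e
  exact ⟨j, (h.infix_of_isChain_of_mem (isChain_of_mem_chunks h1) hw hj).subset hv⟩

theorem mem_segs_iff (h : TwoSinkPaths N T P) (hcd : c ≠ d) :
    a ∈ segs P c i ↔ ∃ j, IsLCS (P c i) (P d j) a := by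
  rw [mem_segs]
  constructor
  · rintro ⟨h1, w, hw, hc⟩
    obtain ⟨j, hj⟩ := hc d
    exact ⟨j, h.isLCS_of_mem_chunks hcd h1 hw hj⟩
  · rintro ⟨j, hj⟩
    obtain ⟨v, hv⟩ := List.exists_mem_of_ne_nil _ hj.1
    exact ⟨h.mem_chunks_of_isLCS hcd hj, v, hv,
      common_of_mem hcd (hj.2.1.subset hv) (hj.2.2.1.subset hv)⟩

theorem _root_.IsLCS.symm {p q a : List V} (h : IsLCS p q a) : IsLCS q p a :=
  ⟨h.1, h.2.2.1, h.2.1, fun b h1 h2 h3 => h.2.2.2 b h1 h3 h2⟩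

theorem isLCS_iff (h : TwoSinkPaths N T P) (hcd : c ≠ d) :
    IsLCS (P c i) (P d j) a ↔ a ∈ segs P c i ∧ a ∈ segs P d j := by
  constructor
  · intro ha
    exact ⟨(h.mem_segs_iff hcd).2 ⟨j, ha⟩, (h.mem_segs_iff hcd.symm).2 ⟨i, ha.symm⟩⟩
  · rintro ⟨h1, h2⟩
    obtain ⟨h1, w, hw, -⟩ := mem_segs.1 h1
    obtain ⟨h2, -⟩ := mem_segs.1 h2
    exact h.isLCS_of_mem_chunks hcd h1 hw ((infix_of_mem_chunks h2).subset hw)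

theorem mem_segs_of_common (h : TwoSinkPaths N T P) (ha : a ∈ chunks P (P c i)) (hv : v ∈ a)
    (hv' : v ∈ P d j) (hc : Common P v) : a ∈ segs P d j := by
  have ha' : a ∈ segs P c i := mem_segs.2 ⟨ha, v, hv, hc⟩
  by_cases hcd : c = d
  · subst hcd
    rwa [← h.index_eq ((infix_of_mem_chunks ha).subset hv) hv' (Common.ne_sink h hc c)]
  · exact ((h.isLCS_iff hcd).1 (h.isLCS_of_mem_chunks hcd ha hv hv')).2

/-- Both ends of a common arc are common vertices, so a run through a vertex that is not common has
no arcs. -/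
theorem chunk_of_not_common (ha : a ∈ chunks P (P c i)) (hv : v ∈ a) (hc : ¬ Common P v) :
    a = [v] := by
  have h1 := isChain_of_mem_chunks ha
  obtain ⟨A, B, rfl⟩ := List.append_of_mem hv
  rcases List.eq_nil_or_concat A with rfl | ⟨A, x, rfl⟩
  · cases B with
    | nil => rfl
    | cons y B =>
      simp at h1
      exact (hc (CommonArc.left h1.1)).elim
  · have : [x, v] <:+: A.concat x ++ v :: B := ⟨A, B, by simp⟩
    have := h1.infix this
    rw [List.isChain_pair] at this
    exact (hc (CommonArc.right this)).elim

/-- Chunks of any two of the paths are equal if they share a vertex. -/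
theorem chunk_eq (h : TwoSinkPaths N T P) (ha : a ∈ chunks P (P c i))
    (hb : b ∈ chunks P (P d j)) (hva : v ∈ a) (hvb : v ∈ b) : a = b := by
  by_cases hc : Common P v
  · have := h.mem_segs_of_common ha hva ((infix_of_mem_chunks hb).subset hvb) hc
    exact eq_of_mem_chunks (h.path_nodup d j) (mem_segs.1 this).1 hb hva hvb
  · rw [chunk_of_not_common ha hva hc, chunk_of_not_common hb hvb hc]

/-- A stretch of a path of colour `d` that leaves and rejoins the same path of colour `c` is a
stretch of that path, since rerouting along it gives another family of disjoint paths. -/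
theorem eq_of_jump (h : TwoSinkPaths N T P) (hcd : c ≠ d) {A B C m : List V}
    (hp : P c i = A ++ x :: (B ++ y :: C)) (hj : x :: (m ++ [y]) <:+: P d j)
    (hm : ∀ u ∈ m, ¬ Common P u) : m = B := by
  -- The inner vertices of the detour lie on colour `d` without being common, so the detour avoids
  -- all paths of colour `c`.
  have hmc : ∀ u ∈ m, ∀ e, u ∉ P c e := fun u hu e he =>
    hm u hu (common_of_mem hcd he (hj.subset (by simp [hu])))
  have hQ : N.IsFamily (T c) (Function.update (P c) i (A ++ x :: (m ++ y :: C))) := by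
    refine ⟨fun e => ?_, fun e e' hee v hv hv' => ?_⟩
    · by_cases he : e = i
      · subst he
        have := (h.fam c).1 e
        rw [Function.update_self]
        refine PairNetwork.isPath_splice (hp ▸ this) (A' := A ++ x :: B)
          (s' := N.s e) ?_ (((h.fam d).1 j).1.infix hj)
        rw [hp] at this
        simpa using this
      · rw [Function.update_of_ne he]
        exact (h.fam c).1 e
    · have key : ∀ e, e ≠ i → v ∈ P c e → v ∈ A ++ x :: (m ++ y :: C) → v = N.t (T c) := by
        intro e he h1 h2
        have : v ∉ m := fun h3 => hmc v h3 e h1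
        refine (h.fam c).2 e i he v h1 ?_
        rw [hp]
        simp [this] at h2 ⊢
        tauto
      by_cases he : e = i
      · subst he
        rw [Function.update_self] at hv
        rw [Function.update_of_ne hee.symm] at hv'
        exact key e' hee.symm hv' hv
      · rw [Function.update_of_ne he] at hv
        by_cases he' : e' = i
        · subst he'
          rw [Function.update_self] at hv'
          exact key e hee hv hv'
        · rw [Function.update_of_ne he'] at hv'
          exact (h.fam c).2 e e' hee v hv hv'
  have := congrFun (h.uniq c _ hQ) i
  rw [Function.update_self, hp] at this
  simpa using this

/-- Two stretches of paths of colour `d` cannot lead from two different paths of colour `c` to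
each other, each ending behind the start of the other one: both paths could be rerouted. -/
theorem not_crossing_vertices (h : TwoSinkPaths N T P) (hcd : c ≠ d) (hii : i ≠ i')
    {A B C A' B' C' m m' : List V} {x' y' : V}
    (hp : P c i = A ++ x :: (B ++ y' :: C)) (hp' : P c i' = A' ++ x' :: (B' ++ y :: C'))
    (hj : x :: (m ++ [y]) <:+: P d j) (hj' : x' :: (m' ++ [y']) <:+: P d j')
    (hm : ∀ u ∈ m, ¬ Common P u) (hm' : ∀ u ∈ m', ¬ Common P u) : False := by
  have hmc : ∀ u ∈ m, ∀ e, u ∉ P c e := fun u hu e he =>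
    hm u hu (common_of_mem hcd he (hj.subset (by simp [hu])))
  have hmc' : ∀ u ∈ m', ∀ e, u ∉ P c e := fun u hu e he =>
    hm' u hu (common_of_mem hcd he (hj'.subset (by simp [hu])))
  have hyc : y ∈ P c i' := by simp [hp']
  have hyc' : y' ∈ P c i := by simp [hp]
  have hy : Common P y := common_of_mem hcd hyc (hj.subset (by simp))
  have hy' : Common P y' := common_of_mem hcd hyc' (hj'.subset (by simp))
  have hyi : y ∉ P c i := fun h1 => hii (h.index_eq h1 hyc (Common.ne_sink h hy c))
  -- The two detours are disjoint. On one path of colour `d`, a shared inner vertex would give them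
  -- the same end, though `y` and `y'` lie on different paths of colour `c`; on two paths it would
  -- be the sink, which has no successor.
  have hmm : ∀ v ∈ m, v ∉ m' := by
    intro v hv hv'
    by_cases hjj : j = j'
    · subst hjj
      have := (h.path_nodup d j).stretch_end_unique hj hj' hm hm' hy hy' hv hv'
      exact hyi (this ▸ hyc')
    · have := (h.fam d).2 j j' hjj v (hj.subset (by simp [hv])) (hj'.subset (by simp [hv']))
      have hvy : v ∈ x :: (m ++ [y]) := by simp [hv]
      have hl : (x :: (m ++ [y])).getLast? = some y := by
        rw [← List.cons_append, List.getLast?_append_of_ne_nil _ (by simp)]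
        rfl
      obtain ⟨w, hw⟩ := List.exists_succ_of_mem hvy hl (by rintro rfl; exact hm _ hv hy)
      have hw' := ((h.fam d).1 j).1.infix (hw.trans hj)
      rw [List.isChain_pair, this] at hw'
      exact N.not_arc_t _ _ hw'
  let Q : Fin 3 → List V := fun e =>
    if e = i then A ++ x :: (m ++ y :: C') else if e = i' then A' ++ x' :: (m' ++ y' :: C)
    else P c e
  have hQi : Q i = A ++ x :: (m ++ y :: C') := by simp [Q]
  have hQi' : Q i' = A' ++ x' :: (m' ++ y' :: C) := by simp [Q, hii.symm]
  have hQe : ∀ e, e ≠ i → e ≠ i' → Q e = P c e := fun e h1 h2 => by simp [Q, h1, h2]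
  have mQi : ∀ v, v ∈ Q i → v ∈ A ++ [x] ∨ v ∈ m ∨ v ∈ y :: C' := by
    intro v hv
    rw [hQi] at hv
    simp only [List.mem_append, List.mem_cons, List.not_mem_nil] at hv ⊢
    tauto
  have mQi' : ∀ v, v ∈ Q i' → v ∈ A' ++ [x'] ∨ v ∈ m' ∨ v ∈ y' :: C := by
    intro v hv
    rw [hQi'] at hv
    simp only [List.mem_append, List.mem_cons, List.not_mem_nil] at hv ⊢
    tauto
  have sA : ∀ v ∈ A ++ [x], v ∈ P c i := fun v hv => by
    have : P c i = (A ++ [x]) ++ (B ++ y' :: C) := by simp [hp]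
    exact this ▸ List.mem_append_left _ hv
  have sA' : ∀ v ∈ A' ++ [x'], v ∈ P c i' := fun v hv => by
    have : P c i' = (A' ++ [x']) ++ (B' ++ y :: C') := by simp [hp']
    exact this ▸ List.mem_append_left _ hv
  have sC : ∀ v ∈ y' :: C, v ∈ P c i := fun v hv => by
    have : P c i = (A ++ x :: B) ++ y' :: C := by simp [hp]
    exact this ▸ List.mem_append_right _ hv
  have sC' : ∀ v ∈ y :: C', v ∈ P c i' := fun v hv => by
    have : P c i' = (A' ++ x' :: B') ++ y :: C' := by simp [hp']
    exact this ▸ List.mem_append_right _ hv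
  have dAC : ∀ v ∈ A ++ [x], v ∉ y' :: C := fun v hv hv' => by
    have hn := h.path_nodup c i
    have : P c i = (A ++ [x]) ++ (B ++ y' :: C) := by simp [hp]
    rw [this] at hn
    exact List.disjoint_of_nodup_append hn hv (List.mem_append_right _ hv')
  have dAC' : ∀ v ∈ A' ++ [x'], v ∉ y :: C' := fun v hv hv' => by
    have hn := h.path_nodup c i'
    have : P c i' = (A' ++ [x']) ++ (B' ++ y :: C') := by simp [hp']
    rw [this] at hn
    exact List.disjoint_of_nodup_append hn hv (List.mem_append_right _ hv')
  have f1 : ∀ v, v ∈ Q i → v ∈ Q i' → v = N.t (T c) := by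
    intro v h1 h2
    rcases mQi v h1 with h1 | h1 | h1 <;> rcases mQi' v h2 with h2 | h2 | h2
    · exact (h.fam c).2 i i' hii v (sA v h1) (sA' v h2)
    · exact (hmc' v h2 i (sA v h1)).elim
    · exact (dAC v h1 h2).elim
    · exact (hmc v h1 i' (sA' v h2)).elim
    · exact (hmm v h1 h2).elim
    · exact (hmc v h1 i (sC v h2)).elim
    · exact (dAC' v h2 h1).elim
    · exact (hmc' v h2 i' (sC' v h1)).elim
    · exact (h.fam c).2 i i' hii v (sC v h2) (sC' v h1)
  have f2 : ∀ e, e ≠ i → e ≠ i' → ∀ v, v ∈ P c e → v ∈ Q i ∨ v ∈ Q i' → v = N.t (T c) := by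
    rintro e hei hei' v h1 (h2 | h2)
    · rcases mQi v h2 with h2 | h2 | h2
      · exact (h.fam c).2 e i hei v h1 (sA v h2)
      · exact (hmc v h2 e h1).elim
      · exact (h.fam c).2 e i' hei' v h1 (sC' v h2)
    · rcases mQi' v h2 with h2 | h2 | h2
      · exact (h.fam c).2 e i' hei' v h1 (sA' v h2)
      · exact (hmc' v h2 e h1).elim
      · exact (h.fam c).2 e i hei v h1 (sC v h2)
  have pi : N.IsPath (N.s i) (N.t (T c)) (A ++ x :: (B ++ y' :: C)) := hp ▸ (h.fam c).1 i
  have pi' : N.IsPath (N.s i') (N.t (T c)) (A' ++ x' :: (B' ++ y :: C')) := hp' ▸ (h.fam c).1 i'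
  have hQ : N.IsFamily (T c) Q := by
    refine ⟨fun e => ?_, fun e e' hee v hv hv' => ?_⟩
    · by_cases he : e = i
      · subst he
        rw [hQi]
        exact PairNetwork.isPath_splice pi (A' := A' ++ x' :: B') (s' := N.s i')
          (by simpa using pi') (((h.fam d).1 j).1.infix hj)
      by_cases he' : e = i'
      · subst he'
        rw [hQi']
        exact PairNetwork.isPath_splice pi' (A' := A ++ x :: B) (s' := N.s i)
          (by simpa using pi) (((h.fam d).1 j').1.infix hj')
      rw [hQe e he he']
      exact (h.fam c).1 e
    · by_cases he : e = i
      · subst he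
        by_cases he' : e' = i'
        · subst he'
          exact f1 v hv hv'
        · rw [hQe e' hee.symm he'] at hv'
          exact f2 e' hee.symm he' v hv' (Or.inl hv)
      · by_cases he' : e = i'
        · subst he'
          by_cases h3 : e' = i
          · subst h3
            exact f1 v hv' hv
          · rw [hQe e' h3 hee.symm] at hv'
            exact f2 e' h3 hee.symm v hv' (Or.inr hv)
        · rw [hQe e he he'] at hv
          by_cases h3 : e' = i
          · subst h3
            exact f2 e he he' v hv (Or.inl hv')
          · by_cases h4 : e' = i'
            · subst h4
              exact f2 e he he' v hv (Or.inr hv')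
            · rw [hQe e' h3 h4] at hv'
              exact (h.fam c).2 e e' hee v hv hv'
  -- The rerouted path `Q i` passes through `y`, which is not on `P c i`.
  have := congrFun (h.uniq c _ hQ) i
  exact hyi (this ▸ hQi ▸ by simp)

end TwoSinkPaths

/-! ### The segments form a segment system -/

namespace TwoSinkPaths

variable {V : Type*} {N : PairNetwork 3 V} {T : Fin 2 → Fin 3} {P : Fin 2 → Fin 3 → List V}
  {c d : Fin 2} {i j i' j' : Fin 3} {a b : List V} {u v w x y : V}

theorem pairwise_transGen (h : TwoSinkPaths N T P) (c : Fin 2) (i : Fin 3) :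
    (P c i).Pairwise (Relation.TransGen N.Arc) :=
  List.isChain_iff_pairwise.1 (((h.fam c).1 i).1.imp fun _ _ h => Relation.TransGen.single h)

theorem transGen_of_sublist_segs (h : TwoSinkPaths N T P) (hab : [a, b].Sublist (segs P c i))
    (hu : u ∈ a) (hv : v ∈ b) : Relation.TransGen N.Arc u v := by
  have h1 : [a, b].Sublist (chunks P (P c i)) := hab.trans List.filter_sublist
  have h2 := h1.flatten
  rw [flatten_chunks] at h2
  have h3 := (h.pairwise_transGen c i).sublist h2
  simp only [List.flatten_cons, List.flatten_nil, List.append_nil, List.pairwise_append] at h3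
  exact h3.2.2 u hu v hv

theorem pair_sublist_of_transGen (h : TwoSinkPaths N T P) (hu : u ∈ P c i) (hv : v ∈ P c i)
    (huv : Relation.TransGen N.Arc u v) : [u, v].Sublist (P c i) := by
  refine (List.pair_sublist_or hu hv ?_).resolve_right fun h1 => ?_
  · rintro rfl
    exact N.acyclic _ huv
  · have := (h.pairwise_transGen c i).sublist h1
    simp only [List.pairwise_cons, List.mem_singleton, forall_eq] at this
    exact N.acyclic _ (huv.trans this.1)

theorem segs_subset (h : a ∈ segs P c i) : a ⊆ P c i :=
  (infix_of_mem_chunks (mem_segs.1 h).1).subset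

theorem ne_nil_of_mem_segs (h : a ∈ segs P c i) : a ≠ [] :=
  ne_nil_of_mem_chunks (mem_segs.1 h).1

theorem nodup_segs (h : TwoSinkPaths N T P) (c : Fin 2) (i : Fin 3) : (segs P c i).Nodup :=
  (nodup_chunks (h.path_nodup c i)).sublist List.filter_sublist

theorem mem_of_head? {α : Type*} {a : α} {l : List α} (h : l.head? = some a) : a ∈ l :=
  List.mem_of_mem_head? (by simp [h])

theorem mem_of_getLast? {α : Type*} {a : α} {l : List α} (h : l.getLast? = some a) : a ∈ l :=
  List.mem_of_mem_getLast? (by simp [h])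

theorem source_mem (h : TwoSinkPaths N T P) (c : Fin 2) (i : Fin 3) : N.s i ∈ P c i :=
  mem_of_head? ((h.fam c).1 i).2.1

theorem sink_mem (h : TwoSinkPaths N T P) (c : Fin 2) (i : Fin 3) : N.t (T c) ∈ P c i :=
  mem_of_getLast? ((h.fam c).1 i).2.2

theorem common_source (h : TwoSinkPaths N T P) (i : Fin 3) : Common P (N.s i) :=
  fun c => ⟨i, h.source_mem c i⟩

/-- The first segment contains the source. -/
theorem exists_first (h : TwoSinkPaths N T P) (i : Fin 3) :
    ∃ s, N.s i ∈ s ∧ ∀ c, ∃ L, segs P c i = s :: L := by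
  classical
  have key : ∀ c, ∃ s, N.s i ∈ s ∧ s ∈ chunks P (P c i) ∧ ∃ L, segs P c i = s :: L := by
    intro c
    rcases hL : chunks P (P c i) with _ | ⟨s, L⟩
    · have := exists_mem_chunks (P := P) (h.source_mem c i)
      simp [hL] at this
    · have hs : s ∈ chunks P (P c i) := by simp [hL]
      have h1 : N.s i ∈ s := by
        have h2 := ((h.fam c).1 i).2.1
        rw [← flatten_chunks (P := P) (P c i), hL, List.flatten_cons,
          List.head?_append_of_ne_nil _ (ne_nil_of_mem_chunks hs)] at h2
        exact mem_of_head? h2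
      refine ⟨s, h1, by simp, L.filter fun a => decide (Meets P a), ?_⟩
      have : Meets P s := ⟨_, h1, h.common_source i⟩
      simp [segs, hL, this]
  obtain ⟨s, hs, hs', -⟩ := key 0
  refine ⟨s, hs, fun c => ?_⟩
  obtain ⟨s', h1, h2, h3⟩ := key c
  rwa [h.chunk_eq hs' h2 hs h1]

/-- By `eq_of_jump` the stretch between the segments also belongs to `P c i`. A single arc would
then be common and would not separate `a` from `b`; an inner vertex would be common, against the
choice of the stretch. -/
theorem not_jump_segs (h : TwoSinkPaths N T P) (hcd : c ≠ d) (hab : [a, b] <:+: segs P d j)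
    (ha : a ∈ segs P c i) (hb : b ∈ segs P c i) : False := by
  obtain ⟨x, y, m, hx, hy, hm, hmc, hne⟩ := exists_jump hab
  have hxa := mem_of_getLast? hx
  have hyb := mem_of_head? hy
  have hxy := h.transGen_of_sublist_segs hab.sublist hxa hyb
  obtain ⟨A, B, C, hp⟩ := List.pair_sublist_iff.1
    (h.pair_sublist_of_transGen (segs_subset ha hxa) (segs_subset hb hyb) hxy)
  obtain rfl := h.eq_of_jump hcd hp hm hmc
  rcases m with _ | ⟨u, m⟩
  · refine hne ⟨rfl, fun e => ?_⟩
    rcases eq_or_eq_of_ne hcd e with rfl | rfl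
    exacts [⟨i, A, C, by simp [hp]⟩, ⟨j, hm⟩]
  · exact hmc u (by simp) (common_of_mem hcd (i := i) (by simp [hp]) (hm.subset (by simp)))

theorem not_crossing_segs (h : TwoSinkPaths N T P) (hcd : c ≠ d) {a' b' : List V}
    (hab : [a, b] <:+: segs P d j) (hab' : [a', b'] <:+: segs P d j')
    (h1 : [a, b'].Sublist (segs P c i)) (h2 : [a', b].Sublist (segs P c i')) : False := by
  have ha : a ∈ segs P c i := h1.subset (by simp)
  have hb : b ∈ segs P c i' := h2.subset (by simp)
  -- On a single path of colour `c` there is no exchange of ends, but already a jump.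
  by_cases hii : i = i'
  · subst hii
    exact h.not_jump_segs hcd hab ha hb
  have ha' : a' ∈ segs P c i' := h2.subset (by simp)
  have hb' : b' ∈ segs P c i := h1.subset (by simp)
  obtain ⟨x, y, m, hx, hy, hm, hmc, -⟩ := exists_jump hab
  obtain ⟨x', y', m', hx', hy', hm', hmc', -⟩ := exists_jump hab'
  replace hx := mem_of_getLast? hx
  replace hy := mem_of_head? hy
  replace hx' := mem_of_getLast? hx'
  replace hy' := mem_of_head? hy'
  obtain ⟨A, B, C, hp⟩ := List.pair_sublist_iff.1 (h.pair_sublist_of_transGen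
    (segs_subset ha hx) (segs_subset hb' hy') (h.transGen_of_sublist_segs h1 hx hy'))
  obtain ⟨A', B', C', hp'⟩ := List.pair_sublist_iff.1 (h.pair_sublist_of_transGen
    (segs_subset ha' hx') (segs_subset hb hy) (h.transGen_of_sublist_segs h2 hx' hy))
  exact h.not_crossing_vertices hcd hii hp hp' hm hm' hmc hmc'

theorem segmentSystem (h : TwoSinkPaths N T P) : SegmentSystem (segs P) where
  nodup := h.nodup_segs
  index {c i i' a} ha ha' := by
    obtain ⟨v, hv⟩ := List.exists_mem_of_ne_nil _ (ne_nil_of_mem_segs ha)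
    exact h.index_eq (segs_subset ha hv) (segs_subset ha' hv)
      (Common.ne_sink h (h.common_of_mem_segs ha hv) c)
  exists_mem {c i a} ha d := by
    obtain ⟨h1, v, hv, hc⟩ := mem_segs.1 ha
    obtain ⟨j, hj⟩ := hc d
    exact ⟨j, h.mem_segs_of_common h1 hv hj hc⟩
  head i := by
    obtain ⟨s, -, hs⟩ := h.exists_first i
    exact ⟨s, hs⟩
  order {c i d j a b} hab hba := by
    obtain ⟨u, hu⟩ := List.exists_mem_of_ne_nil _ (ne_nil_of_mem_segs (hab.subset List.mem_cons_self))
    obtain ⟨v, hv⟩ := List.exists_mem_of_ne_nil _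
      (ne_nil_of_mem_segs (hab.subset (List.mem_cons_of_mem _ List.mem_cons_self)))
    exact N.acyclic u ((h.transGen_of_sublist_segs hab hu hv).trans
      (h.transGen_of_sublist_segs hba hv hu))
  not_jump := h.not_jump_segs
  not_crossing hcd h1 h2 h3 h4 := h.not_crossing_segs hcd h1 h2 h3 h4

end TwoSinkPaths

/-! ### Contraction and suppression -/

namespace TwoSinkPaths

variable {V : Type*} {N : PairNetwork 3 V} {T : Fin 2 → Fin 3} {P : Fin 2 → Fin 3 → List V}
  {r g : Fin 3 → List V} {c d : Fin 2} {i j i' j' : Fin 3} {a b : List V} {u v w x y : V}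

/-- The vertices of the contracted network that are not suppressed. -/
def Essential (N : PairNetwork 3 V) (T : Fin 2 → Fin 3) (P : Fin 2 → Fin 3 → List V)
    (a : List V) : Prop :=
  Meets P a ∨ ∃ c, N.t (T c) ∈ a

theorem not_common_sink (h : TwoSinkPaths N T P) (c : Fin 2) : ¬ Common P (N.t (T c)) :=
  fun hc => Common.ne_sink h hc c rfl

theorem chunk_eq_sink (h : TwoSinkPaths N T P) (ha : a ∈ chunks P (P c i))
    (hd : N.t (T d) ∈ a) : c = d ∧ a = [N.t (T c)] := by
  have hcd : c = d := by
    by_contra hcd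
    exact h.sink_notMem (Ne.symm hcd) ((infix_of_mem_chunks ha).subset hd)
  subst hcd
  exact ⟨rfl, chunk_of_not_common ha hd (h.not_common_sink c)⟩

theorem chunks_eq_append_sink (h : TwoSinkPaths N T P) (c : Fin 2) (i : Fin 3) :
    ∃ L, chunks P (P c i) = L ++ [[N.t (T c)]] := by
  rcases List.eq_nil_or_concat (chunks P (P c i)) with hL | ⟨L, a, hL⟩
  · have := exists_mem_chunks (P := P) (h.sink_mem c i)
    simp [hL] at this
  · have ha : a ∈ chunks P (P c i) := by simp [hL]
    have h1 := ((h.fam c).1 i).2.2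
    rw [← flatten_chunks (P := P) (P c i), hL, List.concat_eq_append, List.flatten_append,
      List.flatten_singleton, List.getLast?_append_of_ne_nil _ (ne_nil_of_mem_chunks ha)] at h1
    exact ⟨L, by rw [hL, (h.chunk_eq_sink ha (mem_of_getLast? h1)).2, List.concat_eq_append]⟩

theorem exists_succ_chunk (h : TwoSinkPaths N T P) (ha : a ∈ chunks P (P c i))
    (hs : N.t (T c) ∉ a) : ∃ b, [a, b] <:+: chunks P (P c i) := by
  obtain ⟨L, hL⟩ := h.chunks_eq_append_sink c i
  refine List.exists_succ_of_mem ha (v := [N.t (T c)]) (by simp [hL]) ?_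
  rintro rfl
  simp at hs

theorem exists_pred_chunk (h : TwoSinkPaths N T P) (ha : a ∈ chunks P (P c i))
    (hs : ¬ Meets P a) : ∃ b, [b, a] <:+: chunks P (P c i) := by
  rcases hL : chunks P (P c i) with _ | ⟨s, L⟩
  · simp [hL] at ha
  · refine List.exists_pred_of_mem (hL ▸ ha) (v := s) rfl ?_
    rintro rfl
    have h2 := ((h.fam c).1 i).2.1
    rw [← flatten_chunks (P := P) (P c i), hL, List.flatten_cons,
      List.head?_append_of_ne_nil _ (ne_nil_of_mem_chunks ha)] at h2
    exact hs ⟨_, mem_of_head? h2, h.common_source i⟩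

open Classical in
/-- The vertices on the `i`-th path of colour `c` in the contracted and suppressed network. -/
theorem filter_essential (h : TwoSinkPaths N T P) (c : Fin 2) (i : Fin 3) :
    (chunks P (P c i)).filter (fun a => decide (Essential N T P a)) =
      segs P c i ++ [[N.t (T c)]] := by
  obtain ⟨L, hL⟩ := h.chunks_eq_append_sink c i
  have hE : Essential N T P [N.t (T c)] := Or.inr ⟨c, by simp⟩
  have hM : ¬ Meets P [N.t (T c)] := by
    rintro ⟨v, hv, hc⟩
    rw [List.mem_singleton] at hv
    exact h.not_common_sink c (hv ▸ hc)
  rw [segs, hL, List.filter_append, List.filter_append]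
  simp only [List.filter_singleton, hE, hM, decide_true, decide_false, cond_true, cond_false,
    List.append_nil, List.append_cancel_right_eq]
  refine List.filter_congr fun a ha => ?_
  rw [decide_eq_decide]
  refine ⟨fun h1 => h1.resolve_right ?_, Or.inl⟩
  rintro ⟨d, hd⟩
  have ha' : a ∈ chunks P (P c i) := by simp [hL, ha]
  obtain ⟨-, rfl⟩ := h.chunk_eq_sink ha' hd
  have hn := nodup_chunks (P := P) (h.path_nodup c i)
  rw [hL] at hn
  exact List.disjoint_of_nodup_append hn ha (by simp)

theorem mem_append_sink_iff (h : TwoSinkPaths N T P) :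
    a ∈ segs P c i ++ [[N.t (T c)]] ↔ a ∈ chunks P (P c i) ∧ Essential N T P a := by
  classical
  rw [← h.filter_essential, List.mem_filter, decide_eq_true_iff]

theorem eq_of_setOf_eq (h : TwoSinkPaths N T P) (ha : a ∈ chunks P (P c i))
    (hb : b ∈ chunks P (P d j)) (hab : {v | v ∈ a} = {v | v ∈ b}) : a = b := by
  obtain ⟨v, hv⟩ := List.exists_mem_of_ne_nil _ (ne_nil_of_mem_chunks ha)
  have hv' : v ∈ {v | v ∈ b} := hab ▸ hv
  exact h.chunk_eq ha hb hv hv'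

open ColoredNet

theorem isBlock_iff (h : TwoSinkPaths N T ![r, g]) {B : Set V} :
    IsBlock r g B ↔
      ∃ c i, ∃ a ∈ chunks ![r, g] (![r, g] c i), B = {v | v ∈ a} := by
  have h01 : (0 : Fin 2) ≠ 1 := by decide
  constructor
  · rintro (⟨i, j, a, ha, rfl⟩ | ⟨v, ⟨i, hv⟩, hv', rfl⟩)
    · exact ⟨0, i, a, h.mem_chunks_of_isLCS h01 (j := j) ha, rfl⟩
    · have hc : ¬ Common ![r, g] v := by
        intro hc
        obtain ⟨i, hi⟩ := hc 0
        obtain ⟨j, hj⟩ := hc 1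
        obtain ⟨a, ha, hva⟩ := exists_mem_chunks (P := ![r, g]) hi
        exact hv' i j a (h.isLCS_of_mem_chunks h01 ha hva hj) hva
      have key : ∀ c, v ∈ ![r, g] c i →
          ∃ c i, ∃ a ∈ chunks ![r, g] (![r, g] c i), {v} = {v | v ∈ a} := by
        intro c hvc
        obtain ⟨a, ha, hva⟩ := exists_mem_chunks (P := ![r, g]) hvc
        refine ⟨c, i, a, ha, ?_⟩
        rw [chunk_of_not_common ha hva hc]
        ext; simp
      exact hv.elim (key 0) (key 1)
  · rintro ⟨c, i, a, ha, rfl⟩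
    obtain ⟨v, hv⟩ := List.exists_mem_of_ne_nil _ (ne_nil_of_mem_chunks ha)
    have hvP := (infix_of_mem_chunks ha).subset hv
    by_cases hc : Common ![r, g] v
    · left
      obtain ⟨i', hi⟩ := hc 0
      obtain ⟨j, hj⟩ := hc 1
      exact ⟨i', j, a, (h.isLCS_iff h01).2
        ⟨h.mem_segs_of_common ha hv hi hc, h.mem_segs_of_common ha hv hj hc⟩, rfl⟩
    · right
      rw [chunk_of_not_common ha hv hc]
      refine ⟨v, ⟨i, ?_⟩, ?_, by ext; simp⟩
      · revert hvP
        match c with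
        | 0 => exact Or.inl
        | 1 => exact Or.inr
      · intro i' j b hb hvb
        exact hc (common_of_mem h01 (hb.2.1.subset hvb) (hb.2.2.1.subset hvb))

/-- An arc of a path either stays inside a chunk and disappears, or leads from the last vertex of a
chunk to the first vertex of the next. -/
theorem contract_arc (h : TwoSinkPaths N T ![r, g]) {B C : {B : Set V // IsBlock r g B}} :
    (contract r g).arc c B C ↔ ∃ i a b, [a, b] <:+: chunks ![r, g] (![r, g] c i) ∧
      B.1 = {v | v ∈ a} ∧ C.1 = {v | v ∈ b} := by
  constructor
  · rintro ⟨hne, u, hu, v, hv, i, huv⟩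
    obtain ⟨c1, i1, a1, ha1, hB⟩ := h.isBlock_iff.1 B.2
    obtain ⟨c2, i2, a2, ha2, hC⟩ := h.isBlock_iff.1 C.2
    have hu' : u ∈ a1 := by rw [hB] at hu; exact hu
    have hv' : v ∈ a2 := by rw [hC] at hv; exact hv
    rw [← flatten_chunks (P := ![r, g]) (![r, g] c i)] at huv
    rcases List.pair_infix_flatten (fun h => ne_nil_of_mem_chunks h rfl) huv with
      ⟨e, he, h1⟩ | ⟨e, f, h1, he, hf⟩
    · refine (hne (Subtype.ext ?_)).elim
      rw [hB, hC, h.chunk_eq ha1 he hu' (h1.subset (by simp)),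
        h.chunk_eq ha2 he hv' (h1.subset (by simp))]
    · refine ⟨i, e, f, h1, ?_, ?_⟩
      · rw [hB, h.chunk_eq ha1 (h1.subset (by simp)) hu' (mem_of_getLast? he)]
      · rw [hC, h.chunk_eq ha2 (h1.subset (by simp)) hv' (mem_of_head? hf)]
  · rintro ⟨i, a, b, hab, hB, hC⟩
    have ha : a ∈ chunks ![r, g] (![r, g] c i) := hab.subset (by simp)
    have hb : b ∈ chunks ![r, g] (![r, g] c i) := hab.subset (by simp)
    have ha' := ne_nil_of_mem_chunks ha
    have hb' := ne_nil_of_mem_chunks hb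
    refine ⟨?_, a.getLast ha', ?_, b.head hb', ?_, i, ?_⟩
    · rintro rfl
      obtain rfl := h.eq_of_setOf_eq ha hb (hB.symm.trans hC)
      have := (nodup_chunks (P := ![r, g]) (h.path_nodup c i)).sublist hab.sublist
      simp at this
    · rw [hB]; exact List.getLast_mem ha'
    · rw [hC]; exact List.head_mem hb'
    · have h1 := infix_flatten hab
      rw [flatten_chunks] at h1
      refine List.IsInfix.trans ⟨a.dropLast, b.tail, ?_⟩ h1
      conv_rhs => rw [List.flatten_cons, ← List.dropLast_append_getLast ha',
        List.flatten_singleton, ← List.cons_head_tail hb']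
      simp

/-- Arcs are counted with their colours. A chunk with a common vertex has outgoing arcs of both
colours, and a sink has none. Any other chunk lies on just one path, with a predecessor because the
source is common and a successor because it is not the sink. -/
theorem isPassing_iff (h : TwoSinkPaths N T ![r, g]) {B : {B : Set V // IsBlock r g B}}
    (ha : a ∈ chunks ![r, g] (![r, g] c i)) (hB : B.1 = {v | v ∈ a}) :
    (contract r g).IsPassing B ↔ ¬ Essential N T ![r, g] a := by
  constructor
  · rintro ⟨-, hout⟩ (hM | ⟨d, hd⟩)
    · obtain ⟨v, hv, hc⟩ := hM
      have key : ∀ e, ∃ C, (contract r g).arc e B C := by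
        intro e
        obtain ⟨j, hj⟩ := hc e
        have hj' := (mem_segs.1 (h.mem_segs_of_common ha hv hj hc)).1
        obtain ⟨b, hb⟩ := h.exists_succ_chunk hj' fun ht =>
          h.not_common_sink e (h.common_of_mem_segs (h.mem_segs_of_common ha hv hj hc) ht)
        exact ⟨⟨{v | v ∈ b}, h.isBlock_iff.2 ⟨e, j, b, hb.subset (by simp), rfl⟩⟩,
          h.contract_arc.2 ⟨j, a, b, hb, hB, rfl⟩⟩
      obtain ⟨C, hC⟩ := key 0
      obtain ⟨D, hD⟩ := key 1
      have := hout.unique (y₁ := (0, C)) (y₂ := (1, D)) hC hD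
      simp at this
    · obtain ⟨⟨e, C⟩, hC, -⟩ := hout
      obtain ⟨j, a', b, hab, h1, h2⟩ := h.contract_arc.1 hC
      have ha' : a' ∈ chunks ![r, g] (![r, g] e j) := hab.subset (by simp)
      obtain rfl := h.eq_of_setOf_eq ha ha' (hB.symm.trans h1)
      obtain ⟨-, rfl⟩ := h.chunk_eq_sink ha' hd
      obtain ⟨L, hL⟩ := h.chunks_eq_append_sink e j
      exact (nodup_chunks (P := ![r, g]) (h.path_nodup e j)).not_pair_infix_of_getLast?
        (by rw [hL, List.getLast?_concat]) hab
  · intro hE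
    have hM : ¬ Meets ![r, g] a := fun h1 => hE (Or.inl h1)
    have ht : ∀ d, N.t (T d) ∉ a := fun d h1 => hE (Or.inr ⟨d, h1⟩)
    have uniq : ∀ {e j}, a ∈ chunks ![r, g] (![r, g] e j) → e = c ∧ j = i := by
      intro e j hej
      obtain ⟨v, hv⟩ := List.exists_mem_of_ne_nil _ (ne_nil_of_mem_chunks ha)
      have h1 := (infix_of_mem_chunks ha).subset hv
      have h2 := (infix_of_mem_chunks hej).subset hv
      have hec : e = c := by
        by_contra hec
        exact hM ⟨v, hv, common_of_mem hec h2 h1⟩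
      subst hec
      exact ⟨rfl, h.index_eq h2 h1 fun hvt => ht e (hvt ▸ hv)⟩
    have hn := nodup_chunks (P := ![r, g]) (h.path_nodup c i)
    obtain ⟨b, hb⟩ := h.exists_pred_chunk ha hM
    obtain ⟨b', hb'⟩ := h.exists_succ_chunk ha (ht c)
    have hbb : IsBlock r g {v | v ∈ b} := h.isBlock_iff.2 ⟨c, i, b, hb.subset (by simp), rfl⟩
    have hbb' : IsBlock r g {v | v ∈ b'} := h.isBlock_iff.2 ⟨c, i, b', hb'.subset (by simp), rfl⟩
    refine ⟨⟨(c, ⟨_, hbb⟩), h.contract_arc.2 ⟨i, b, a, hb, rfl, hB⟩, ?_⟩,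
      ⟨(c, ⟨_, hbb'⟩), h.contract_arc.2 ⟨i, a, b', hb', hB, rfl⟩, ?_⟩⟩
    · rintro ⟨e, C⟩ hC
      obtain ⟨j, f, a', hab, h1, h2⟩ := h.contract_arc.1 hC
      have ha' : a' ∈ chunks ![r, g] (![r, g] e j) := hab.subset (by simp)
      obtain rfl := h.eq_of_setOf_eq ha ha' (hB.symm.trans h2)
      obtain ⟨rfl, rfl⟩ := uniq ha'
      obtain rfl := hn.pred_unique hb hab
      exact Prod.ext rfl (Subtype.ext h1)
    · rintro ⟨e, C⟩ hC
      obtain ⟨j, a', f, hab, h1, h2⟩ := h.contract_arc.1 hC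
      have ha' : a' ∈ chunks ![r, g] (![r, g] e j) := hab.subset (by simp)
      obtain rfl := h.eq_of_setOf_eq ha ha' (hB.symm.trans h1)
      obtain ⟨rfl, rfl⟩ := uniq ha'
      obtain rfl := hn.succ_unique hb' hab
      exact Prod.ext rfl (Subtype.ext h2)

/-- Arcs of colour `c` that meet in a suppressed block belong to the same path, because its vertices
are not sinks; so they merge into one stretch. -/
theorem exists_infix_of_isChain (h : TwoSinkPaths N T ![r, g])
    {B C : {B : Set V // IsBlock r g B}} {l : List {B : Set V // IsBlock r g B}}
    (hl : ∀ w ∈ l, (contract r g).IsPassing w)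
    (hc : (B :: (l ++ [C])).IsChain ((contract r g).arc c)) :
    ∃ i a m b, a :: (m ++ [b]) <:+: chunks ![r, g] (![r, g] c i) ∧ B.1 = {v | v ∈ a} ∧
      C.1 = {v | v ∈ b} ∧ ∀ e ∈ m, ¬ Essential N T ![r, g] e := by
  induction l generalizing B with
  | nil =>
    simp only [List.nil_append, List.isChain_cons_cons, List.isChain_singleton, and_true] at hc
    obtain ⟨i, a, b, hab, h1, h2⟩ := h.contract_arc.1 hc
    exact ⟨i, a, [], b, hab, h1, h2, by simp⟩
  | cons D l ih =>
    rw [List.cons_append, List.isChain_cons_cons] at hc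
    obtain ⟨i, a, m, b, hab, h1, h2, hm⟩ := ih (fun w hw => hl w (by simp [hw])) hc.2
    obtain ⟨i', a', b', hab', h1', h2'⟩ := h.contract_arc.1 hc.1
    have ha : a ∈ chunks ![r, g] (![r, g] c i) := hab.subset (by simp)
    have hb' : b' ∈ chunks ![r, g] (![r, g] c i') := hab'.subset (by simp)
    obtain rfl := h.eq_of_setOf_eq ha hb' (h1.symm.trans h2')
    have hE := (h.isPassing_iff ha h1).1 (hl D (by simp))
    have hii : i' = i := by
      obtain ⟨v, hv⟩ := List.exists_mem_of_ne_nil _ (ne_nil_of_mem_chunks ha)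
      exact h.index_eq ((infix_of_mem_chunks hb').subset hv) ((infix_of_mem_chunks ha).subset hv)
        fun hvt => hE (Or.inr ⟨c, hvt ▸ hv⟩)
    subst hii
    refine ⟨i', a', a :: m, b,
      (nodup_chunks (P := ![r, g]) (h.path_nodup c i')).infix_merge hab' hab, h1', h2, ?_⟩
    intro e he
    rcases List.mem_cons.1 he with rfl | he
    exacts [hE, hm e he]

theorem exists_isChain_of_infix (h : TwoSinkPaths N T ![r, g])
    {B C : {B : Set V // IsBlock r g B}} {m : List (List V)}
    (hab : a :: (m ++ [b]) <:+: chunks ![r, g] (![r, g] c i)) (hB : B.1 = {v | v ∈ a})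
    (hC : C.1 = {v | v ∈ b}) (hm : ∀ e ∈ m, ¬ Essential N T ![r, g] e) :
    ∃ l : List {B : Set V // IsBlock r g B}, (∀ w ∈ l, (contract r g).IsPassing w) ∧
      (B :: (l ++ [C])).IsChain ((contract r g).arc c) := by
  induction m generalizing a B with
  | nil => exact ⟨[], by simp, by simpa using h.contract_arc.2 ⟨i, a, b, hab, hB, hC⟩⟩
  | cons e m ih =>
    have h1 : [a, e] <:+: chunks ![r, g] (![r, g] c i) :=
      List.IsInfix.trans ⟨[], m ++ [b], by simp⟩ hab
    have h2 : e :: (m ++ [b]) <:+: chunks ![r, g] (![r, g] c i) :=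
      List.IsInfix.trans ⟨[a], [], by simp⟩ hab
    have he : e ∈ chunks ![r, g] (![r, g] c i) := h1.subset (by simp)
    let D : {B : Set V // IsBlock r g B} := ⟨{v | v ∈ e}, h.isBlock_iff.2 ⟨c, i, e, he, rfl⟩⟩
    obtain ⟨l, hl, hch⟩ := ih (B := D) h2 rfl fun e he => hm e (by simp [he])
    refine ⟨D :: l, ?_, ?_⟩
    · intro w hw
      rcases List.mem_cons.1 hw with rfl | hw
      exacts [(h.isPassing_iff he rfl).2 (hm e (by simp)), hl w hw]
    · rw [List.cons_append, List.isChain_cons_cons]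
      exact ⟨h.contract_arc.2 ⟨i, a, e, h1, hB, rfl⟩, hch⟩

theorem suppress_arc (h : TwoSinkPaths N T ![r, g])
    {B C : {w : {B : Set V // IsBlock r g B} // ¬ (contract r g).IsPassing w}} :
    (contract r g).suppress.arc c B C ↔
      ∃ i a b, [a, b] <:+: segs ![r, g] c i ++ [[N.t (T c)]] ∧ B.1.1 = {v | v ∈ a} ∧
        C.1.1 = {v | v ∈ b} := by
  classical
  simp only [← h.filter_essential, List.pair_infix_filter, decide_eq_true_iff]
  constructor
  · rintro ⟨l, hl, hc⟩
    obtain ⟨i, a, m, b, hab, h1, h2, hm⟩ := h.exists_infix_of_isChain hl hc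
    refine ⟨i, a, b, ⟨?_, ?_, m, hab, hm⟩, h1, h2⟩
    · by_contra hE
      exact B.2 ((h.isPassing_iff (hab.subset (by simp)) h1).2 hE)
    · by_contra hE
      exact C.2 ((h.isPassing_iff (hab.subset (by simp)) h2).2 hE)
  · rintro ⟨i, a, b, ⟨-, -, m, hab, hm⟩, h1, h2⟩
    exact h.exists_isChain_of_infix hab h1 h2 hm

theorem contract_src (h : TwoSinkPaths N T ![r, g]) {B : {B : Set V // IsBlock r g B}} :
    (contract r g).src i B ↔ N.s i ∈ B.1 := by
  have h0 : (r i).head? = some (N.s i) := ((h.fam 0).1 i).2.1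
  have h1 : (g i).head? = some (N.s i) := ((h.fam 1).1 i).2.1
  simp [contract, ofPaths, h0, h1]

theorem contract_snk (h : TwoSinkPaths N T ![r, g]) {B : {B : Set V // IsBlock r g B}} :
    (contract r g).snk c B ↔ N.t (T c) ∈ B.1 := by
  have h0 : ∀ i, (![r, g] c i).getLast? = some (N.t (T c)) := fun i => ((h.fam c).1 i).2.2
  simp only [contract, ofPaths, h0, Option.some.injEq, forall_const, exists_eq_right']

/-- A labelling of the segments and of the sinks which maps the paths of a network to the lists
of segments, followed by the sink, is an isomorphism. -/
theorem isomorphic_ofPaths (h : TwoSinkPaths N T ![r, g]) {n : ℕ} {ρ γ : Fin 3 → List (Fin n)}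
    (f : Fin n → List V) (hf : Function.Injective f) (σ : Equiv.Perm (Fin 3))
    (τ : Equiv.Perm (Fin 2)) (hmem : ∀ m, ∃ c i, m ∈ ![ρ, γ] c i)
    (hmap : ∀ c i, segs ![r, g] (τ c) (σ i) ++ [[N.t (T (τ c))]] = (![ρ, γ] c i).map f) :
    (contract r g).suppress.Isomorphic (ofPaths ρ γ) := by
  have hfm : ∀ m, ∃ c i, f m ∈ chunks ![r, g] (![r, g] c i) ∧ Essential N T ![r, g] (f m) := by
    intro m
    obtain ⟨c, i, hm⟩ := hmem m
    refine ⟨τ c, σ i, h.mem_append_sink_iff.1 ?_⟩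
    rw [hmap]
    exact List.mem_map_of_mem hm
  have hblock : ∀ m, IsBlock r g {v | v ∈ f m} := by
    intro m
    obtain ⟨c, i, hm, -⟩ := hfm m
    exact h.isBlock_iff.2 ⟨c, i, f m, hm, rfl⟩
  have hpass : ∀ m, ¬ (contract r g).IsPassing ⟨_, hblock m⟩ := by
    intro m
    obtain ⟨c, i, hm, hE⟩ := hfm m
    rw [h.isPassing_iff hm rfl, not_not]
    exact hE
  let φ : Fin n → {w : {B : Set V // IsBlock r g B} // ¬ (contract r g).IsPassing w} :=
    fun m => ⟨⟨_, hblock m⟩, hpass m⟩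
  have hφ : ∀ m, (φ m).1.1 = {v | v ∈ f m} := fun m => rfl
  have hset : ∀ {c i m a}, a ∈ segs ![r, g] c i ++ [[N.t (T c)]] →
      {v | v ∈ f m} = {v | v ∈ a} → f m = a := by
    intro c i m a ha he
    obtain ⟨c', i', hm, -⟩ := hfm m
    exact h.eq_of_setOf_eq hm (h.mem_append_sink_iff.1 ha).1 he
  have hbij : Function.Bijective φ := by
    constructor
    · intro m m' hmm
      apply hf
      obtain ⟨c, i, hm⟩ := hfm m
      obtain ⟨c', i', hm'⟩ := hfm m'
      exact h.eq_of_setOf_eq hm.1 hm'.1 (congrArg (fun x => x.1.1) hmm)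
    -- A surviving block is an essential chunk, hence an entry of one of the lists covered by
    -- `hmap`.
    · rintro ⟨⟨B, hB⟩, hp⟩
      obtain ⟨c, i, a, ha, rfl⟩ := h.isBlock_iff.1 hB
      rw [h.isPassing_iff ha rfl, not_not] at hp
      have h1 := h.mem_append_sink_iff.2 ⟨ha, hp⟩
      obtain ⟨c, rfl⟩ := τ.surjective c
      obtain ⟨i, rfl⟩ := σ.surjective i
      rw [hmap, List.mem_map] at h1
      obtain ⟨m, -, rfl⟩ := h1
      exact ⟨m, rfl⟩
  -- The labelling leads from the configuration to the network, whereas `Isomorphic` asks for the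
  -- opposite direction; hence the inverses.
  refine ⟨(Equiv.ofBijective φ hbij).symm, σ.symm, τ.symm, ?_, ?_, ?_⟩
  · intro c B C
    obtain ⟨m, rfl⟩ := hbij.2 B
    obtain ⟨m', rfl⟩ := hbij.2 C
    obtain ⟨c, rfl⟩ := τ.surjective c
    rw [Equiv.ofBijective_symm_apply_apply, Equiv.ofBijective_symm_apply_apply,
      Equiv.symm_apply_apply, h.suppress_arc]
    constructor
    · rintro ⟨i, a, b, hab, h1, h2⟩
      obtain ⟨i, rfl⟩ := σ.surjective i
      have ha := hset (hab.subset List.mem_cons_self) h1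
      have hb := hset (hab.subset (List.mem_cons_of_mem _ List.mem_cons_self)) h2
      rw [← ha, ← hb, hmap, List.pair_infix_map hf] at hab
      exact ⟨i, hab⟩
    · rintro ⟨i, hi⟩
      refine ⟨σ i, f m, f m', ?_, rfl, rfl⟩
      rwa [hmap, List.pair_infix_map hf]
  · intro i B
    obtain ⟨m, rfl⟩ := hbij.2 B
    obtain ⟨i, rfl⟩ := σ.surjective i
    rw [Equiv.ofBijective_symm_apply_apply, Equiv.symm_apply_apply]
    change (contract r g).src (σ i) (φ m).1 ↔ _
    rw [h.contract_src]
    obtain ⟨s, hs, hsL⟩ := h.exists_first (σ i)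
    have hhead : ∀ c, (![ρ, γ] c i).head?.map f = some s := by
      intro c
      obtain ⟨L, hL⟩ := hsL (τ c)
      have := congrArg List.head? (hmap c i)
      rw [hL, List.head?_map] at this
      exact this.symm
    have key : N.s (σ i) ∈ (φ m).1.1 ↔ f m = s := by
      rw [hφ]
      constructor
      · intro h1
        obtain ⟨c, i', hm, -⟩ := hfm m
        obtain ⟨L, hL⟩ := hsL 0
        exact h.chunk_eq hm (mem_segs.1 (hL ▸ List.mem_cons_self)).1 h1 hs
      · rintro rfl
        exact hs
    have key2 : ∀ c, (![ρ, γ] c i).head? = some m ↔ f m = s := by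
      intro c
      have := hhead c
      cases hc : (![ρ, γ] c i).head? with
      | none => rw [hc] at this; simp at this
      | some m' =>
        rw [hc, Option.map_some, Option.some_inj] at this
        rw [← this, Option.some_inj, hf.eq_iff, eq_comm]
    rw [key]
    exact ⟨fun h1 => ⟨(key2 0).2 h1, (key2 1).2 h1⟩, fun h1 => (key2 0).1 h1.1⟩
  · intro c B
    obtain ⟨m, rfl⟩ := hbij.2 B
    obtain ⟨c, rfl⟩ := τ.surjective c
    rw [Equiv.ofBijective_symm_apply_apply, Equiv.symm_apply_apply]
    change (contract r g).snk (τ c) (φ m).1 ↔ _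
    rw [h.contract_snk, hφ]
    have key : N.t (T (τ c)) ∈ {v | v ∈ f m} ↔ f m = [N.t (T (τ c))] := by
      constructor
      · intro h1
        obtain ⟨d, i', hm, -⟩ := hfm m
        obtain ⟨h2, h3⟩ := h.chunk_eq_sink hm h1
        rw [h3, h2]
      · intro h1
        rw [h1]
        exact List.mem_singleton.2 rfl
    have key2 : ∀ i, (![ρ, γ] c i).getLast? = some m ↔ f m = [N.t (T (τ c))] := by
      intro i
      have := congrArg List.getLast? (hmap c i)
      rw [List.getLast?_map, List.getLast?_append_of_ne_nil _ (by simp),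
        List.getLast?_singleton] at this
      cases hc : (![ρ, γ] c i).getLast? with
      | none => rw [hc] at this; simp at this
      | some m' =>
        rw [hc, Option.map_some, Option.some_inj] at this
        rw [this, Option.some_inj, hf.eq_iff, eq_comm]
    rw [key]
    exact ⟨fun h1 i => (key2 i).2 h1, fun h1 => (key2 0).1 (h1 0)⟩

end TwoSinkPaths

/-! ### Counting segments and matching the configurations -/

namespace TwoSinkPaths

variable {V : Type*} {N : PairNetwork 3 V} {T : Fin 2 → Fin 3} {P : Fin 2 → Fin 3 → List V}
  {r g : Fin 3 → List V} {c d : Fin 2} {i j l : Fin 3} {a b : List V} {u v w x y : V}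

theorem segmentsOn_eq (h : TwoSinkPaths N T ![r, g]) (c : Fin 2) (i : Fin 3) :
    segmentsOn r g (![r, g] c i) = {a | a ∈ segs ![r, g] c i} := by
  have h01 : (0 : Fin 2) ≠ 1 := by decide
  ext a
  constructor
  · rintro ⟨hac, i', j, ha⟩
    obtain ⟨v, hv⟩ := List.exists_mem_of_ne_nil _ ha.1
    have h1 : a ∈ segs ![r, g] 0 i' := ((h.isLCS_iff h01).1 ha).1
    exact h.mem_segs_of_common (mem_segs.1 h1).1 hv (hac.subset hv) (h.common_of_mem_segs h1 hv)
  · intro ha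
    obtain ⟨i', hi⟩ := h.segmentSystem.exists_mem ha 0
    obtain ⟨j, hj⟩ := h.segmentSystem.exists_mem ha 1
    exact ⟨infix_of_mem_chunks (mem_segs.1 ha).1, i', j, (h.isLCS_iff h01).2 ⟨hi, hj⟩⟩

theorem ncard_setOf_mem {α : Type*} {L : List α} (hL : L.Nodup) :
    {a | a ∈ L}.ncard = L.length := by
  classical
  rw [← List.toFinset_card_of_nodup hL, ← Set.ncard_coe_finset]
  congr 1
  ext
  simp

theorem numSegments_eq (h : TwoSinkPaths N T ![r, g]) (c : Fin 2) (i : Fin 3) :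
    numSegments r g (![r, g] c i) = (segs ![r, g] c i).length := by
  rw [numSegments, h.segmentsOn_eq, ncard_setOf_mem (h.nodup_segs c i)]

/-- Along one path, the order of the list agrees with `Before`, so exactly the members of `L`
precede `a`; the added `1` comes from counting from `1`. -/
theorem isNthSegment (h : TwoSinkPaths N T ![r, g]) {L M : List (List V)}
    (hs : segs ![r, g] c i = L ++ a :: M) :
    N.IsNthSegment r g (![r, g] c i) (L.length + 1) a := by
  have ha : a ∈ segs ![r, g] c i := by simp [hs]
  have hn := h.nodup_segs c i
  rw [hs] at hn
  refine ⟨h.segmentsOn_eq c i ▸ ha, ?_⟩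
  have key : {b ∈ segmentsOn r g (![r, g] c i) | N.Before b a} = {b | b ∈ L} := by
    rw [h.segmentsOn_eq]
    ext b
    constructor
    · rintro ⟨hb, u, v, hu, hv, huv⟩
      have hub := mem_of_getLast? hu
      have hva := mem_of_head? hv
      rw [Set.mem_ofPred_eq, hs, List.mem_append, List.mem_cons] at hb
      rcases hb with hb | rfl | hb
      · exact hb
      -- A segment is not before itself: its last vertex does not strictly precede its first one.
      · exfalso
        have hp := (h.pairwise_transGen c i).sublist (infix_of_mem_chunks (mem_segs.1 ha).1).sublist
        cases b with
        | nil => simp at hv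
        | cons w b =>
          simp only [List.head?_cons, Option.some.injEq] at hv
          subst hv
          rcases List.mem_cons.1 hub with rfl | hub
          · exact N.acyclic _ huv
          · exact N.acyclic _ (huv.trans ((List.pairwise_cons.1 hp).1 u hub))
      · exfalso
        have : [a, b].Sublist (segs ![r, g] c i) := by
          obtain ⟨M1, M2, rfl⟩ := List.append_of_mem hb
          exact List.pair_sublist_iff.2 ⟨L, M1, M2, hs⟩
        exact N.acyclic _ (huv.trans (h.transGen_of_sublist_segs this hva hub))
    · intro hb
      have hsub : [b, a].Sublist (segs ![r, g] c i) := by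
        obtain ⟨M1, M2, rfl⟩ := List.append_of_mem hb
        exact List.pair_sublist_iff.2 ⟨M1, M2, M, by simp [hs]⟩
      have hb' : b ∈ segs ![r, g] c i := hsub.subset (by simp)
      have h1 := ne_nil_of_mem_segs hb'
      have h2 := ne_nil_of_mem_segs ha
      exact ⟨hb', b.getLast h1, a.head h2, List.getLast?_eq_some_getLast h1,
        List.head?_eq_some_head h2,
        h.transGen_of_sublist_segs hsub (List.getLast_mem h1) (List.head_mem h2)⟩
  rw [key, ncard_setOf_mem (List.Nodup.of_append_left hn)]

/-- Every segment lies on a path of colour `c`, so these lists and the two sinks supply all labels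
of a configuration, and their distinctness makes the labelling injective. -/
theorem nodup_all (h : TwoSinkPaths N T P) (hcd : c ≠ d) (hij : i ≠ j) (hil : i ≠ l)
    (hjl : j ≠ l) :
    (segs P c i ++ (segs P c j ++ (segs P c l ++ [[N.t (T c)], [N.t (T d)]]))).Nodup := by
  have hdis : ∀ {i j}, i ≠ j → ∀ a, a ∈ segs P c i → ∀ b, b ∈ segs P c j → a ≠ b := by
    rintro i j hij a ha b hb rfl
    exact hij (h.segmentSystem.index ha hb)
  have hsink : ∀ {i e a}, a ∈ segs P c i → a ≠ [N.t (T e)] := by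
    rintro i e a ha rfl
    exact h.not_common_sink e (h.common_of_mem_segs ha (by simp))
  have htt : N.t (T c) ≠ N.t (T d) := fun he => hcd (h.inj (N.t_injective he))
  simp only [List.nodup_append, List.mem_append, List.mem_cons, List.not_mem_nil, or_false]
  refine ⟨h.nodup_segs c i, ⟨h.nodup_segs c j, ⟨h.nodup_segs c l, by simp [htt], ?_⟩, ?_⟩, ?_⟩
  · rintro a ha b (rfl | rfl) <;> exact hsink ha
  · rintro a ha b (hb | rfl | rfl)
    exacts [hdis hjl a ha b hb, hsink ha, hsink ha]
  · rintro a ha b (hb | hb | rfl | rfl)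
    exacts [hdis hij a ha b hb, hdis hil a ha b hb, hsink ha, hsink ha]

open ColoredNet

theorem isomorphic_of_lists (h : TwoSinkPaths N T ![r, g]) {n : ℕ} {ρ γ : Fin 3 → List (Fin n)}
    (f : Fin n → List V) (hcd : c ≠ d) (hij : i ≠ j) (hil : i ≠ l) (hjl : j ≠ l)
    (hf : (List.ofFn f).Nodup) (hmem : ∀ m, ∃ c i, m ∈ ![ρ, γ] c i)
    (h1 : segs ![r, g] c i ++ [[N.t (T c)]] = (ρ 0).map f)
    (h2 : segs ![r, g] c j ++ [[N.t (T c)]] = (ρ 1).map f)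
    (h3 : segs ![r, g] c l ++ [[N.t (T c)]] = (ρ 2).map f)
    (h4 : segs ![r, g] d i ++ [[N.t (T d)]] = (γ 0).map f)
    (h5 : segs ![r, g] d j ++ [[N.t (T d)]] = (γ 1).map f)
    (h6 : segs ![r, g] d l ++ [[N.t (T d)]] = (γ 2).map f) :
    (contract r g).suppress.Isomorphic (ofPaths ρ γ) := by
  have hσ : Function.Bijective ![i, j, l] := by
    rw [← Finite.injective_iff_bijective, ← List.nodup_ofFn]
    simp [hij, hil, hjl]
  have hτ : Function.Bijective ![c, d] := by
    rw [← Finite.injective_iff_bijective, ← List.nodup_ofFn]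
    simp [hcd]
  refine h.isomorphic_ofPaths f (List.nodup_ofFn.1 hf) (Equiv.ofBijective _ hσ)
    (Equiv.ofBijective _ hτ) hmem ?_
  rw [Fin.forall_fin_two]
  exact ⟨Fin.forall_fin_succ.2 ⟨h1, Fin.forall_fin_two.2 ⟨h2, h3⟩⟩,
    Fin.forall_fin_succ.2 ⟨h4, Fin.forall_fin_two.2 ⟨h5, h6⟩⟩⟩

section Configurations

variable {si sj sl X Y Z W : List V}

theorem isomorphic_config111 (h : TwoSinkPaths N T ![r, g]) (hcd : c ≠ d) (hij : i ≠ j)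
    (hil : i ≠ l) (hjl : j ≠ l) (hi : segs ![r, g] c i = [si]) (hl : segs ![r, g] d l = [sl])
    (hj : segs ![r, g] c j = [sj, X]) (hl' : segs ![r, g] c l = [sl, Y])
    (hi' : segs ![r, g] d i = [si, X]) (hj' : segs ![r, g] d j = [sj, Y]) :
    (contract r g).suppress.Isomorphic config111 := by
  refine h.isomorphic_of_lists ![si, sj, sl, [N.t (T c)], [N.t (T d)], X, Y] hcd hij hil hjl
    ?_ (by decide) ?_ ?_ ?_ ?_ ?_ ?_
  · have hn := h.nodup_all hcd hij hil hjl
    rw [hi, hj, hl'] at hn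
    simp at hn ⊢
    grind
  all_goals simp [hi, hl, hj, hl', hi', hj']

theorem isomorphic_config112 (h : TwoSinkPaths N T ![r, g]) (hcd : c ≠ d) (hij : i ≠ j)
    (hil : i ≠ l) (hjl : j ≠ l) (hi : segs ![r, g] c i = [si]) (hl : segs ![r, g] d l = [sl])
    (hj : segs ![r, g] c j = [sj, X, Z]) (hl' : segs ![r, g] c l = [sl, Y])
    (hi' : segs ![r, g] d i = [si, X]) (hj' : segs ![r, g] d j = [sj, Y, Z]) :
    (contract r g).suppress.Isomorphic config112 := by
  refine h.isomorphic_of_lists ![si, sj, sl, [N.t (T c)], [N.t (T d)], X, Y, Z] hcd hij hil hjl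
    ?_ (by decide) ?_ ?_ ?_ ?_ ?_ ?_
  · have hn := h.nodup_all hcd hij hil hjl
    rw [hi, hj, hl'] at hn
    simp at hn ⊢
    grind
  all_goals simp [hi, hl, hj, hl', hi', hj']

theorem isomorphic_config121 (h : TwoSinkPaths N T ![r, g]) (hcd : c ≠ d) (hij : i ≠ j)
    (hil : i ≠ l) (hjl : j ≠ l) (hi : segs ![r, g] c i = [si]) (hl : segs ![r, g] d l = [sl])
    (hj : segs ![r, g] c j = [sj, X]) (hl' : segs ![r, g] c l = [sl, Y, W])
    (hi' : segs ![r, g] d i = [si, X, W]) (hj' : segs ![r, g] d j = [sj, Y]) :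
    (contract r g).suppress.Isomorphic config121 := by
  refine h.isomorphic_of_lists ![si, sj, sl, [N.t (T c)], [N.t (T d)], X, Y, W] hcd hij hil hjl
    ?_ (by decide) ?_ ?_ ?_ ?_ ?_ ?_
  · have hn := h.nodup_all hcd hij hil hjl
    rw [hi, hj, hl'] at hn
    simp at hn ⊢
    grind
  all_goals simp [hi, hl, hj, hl', hi', hj']

theorem isomorphic_config1221 (h : TwoSinkPaths N T ![r, g]) (hcd : c ≠ d) (hij : i ≠ j)
    (hil : i ≠ l) (hjl : j ≠ l) (hi : segs ![r, g] c i = [si]) (hl : segs ![r, g] d l = [sl])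
    (hj : segs ![r, g] c j = [sj, X]) (hl' : segs ![r, g] c l = [sl, W, Y])
    (hi' : segs ![r, g] d i = [si, X, W]) (hj' : segs ![r, g] d j = [sj, Y]) :
    (contract r g).suppress.Isomorphic config1221 := by
  refine h.isomorphic_of_lists ![si, sj, sl, [N.t (T c)], [N.t (T d)], X, Y, W] hcd hij hil hjl
    ?_ (by decide) ?_ ?_ ?_ ?_ ?_ ?_
  · have hn := h.nodup_all hcd hij hil hjl
    rw [hi, hj, hl'] at hn
    simp at hn ⊢
    grind
  all_goals simp [hi, hl, hj, hl', hi', hj']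

theorem isomorphic_config1222 (h : TwoSinkPaths N T ![r, g]) (hcd : c ≠ d) (hij : i ≠ j)
    (hil : i ≠ l) (hjl : j ≠ l) (hi : segs ![r, g] c i = [si]) (hl : segs ![r, g] d l = [sl])
    (hj : segs ![r, g] c j = [sj, X, Z]) (hl' : segs ![r, g] c l = [sl, W, Y])
    (hi' : segs ![r, g] d i = [si, X, W]) (hj' : segs ![r, g] d j = [sj, Y, Z]) :
    (contract r g).suppress.Isomorphic config1222 := by
  refine h.isomorphic_of_lists ![si, sj, sl, [N.t (T c)], [N.t (T d)], X, Y, W, Z] hcd hij hil hjl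
    ?_ (by decide) ?_ ?_ ?_ ?_ ?_ ?_
  · have hn := h.nodup_all hcd hij hil hjl
    rw [hi, hj, hl'] at hn
    simp at hn ⊢
    grind
  all_goals simp [hi, hl, hj, hl', hi', hj']

end Configurations

theorem existsUnique_isLCS (h : TwoSinkPaths N T ![r, g]) (hcd : c ≠ d) (hij : i ≠ j)
    (hil : i ≠ l) (hjl : j ≠ l) {si sj sl X Y : List V} {A B C D : List (List V)}
    (hi : segs ![r, g] c i = [si]) (hl : segs ![r, g] d l = [sl])
    (hj : segs ![r, g] c j = sj :: X :: A) (hl' : segs ![r, g] c l = sl :: B)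
    (hi' : segs ![r, g] d i = si :: C) (hj' : segs ![r, g] d j = sj :: Y :: D) :
    ∃! x, IsLCS (![r, g] d i) (![r, g] c j) x := by
  simp only [h.isLCS_iff hcd.symm]
  refine ⟨X, ⟨h.segmentSystem.mem_of_second hcd hij hil hjl hl hl' hj, by simp [hj]⟩, ?_⟩
  rintro X' ⟨h1, h2⟩
  exact h.segmentSystem.eq_of_mem_of_mem hcd hij hil hjl hi hl hj hl' hi' hj' h2 h1

/-- `NonDegenerated` only restricts pairs with distinct indices. Applying `eq_of_length_eq_one` in
both colour roles upgrades this to a unique short path in each colour. -/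
theorem exists_unique_short (h : TwoSinkPaths N T ![r, g]) (hnd : NonDegenerated r g) :
    ∃ i l, i ≠ l ∧ (∀ p, (segs ![r, g] 0 p).length = 1 ↔ p = i) ∧
      ∀ q, (segs ![r, g] 1 q).length = 1 ↔ q = l := by
  have h0 : ∀ i, numSegments r g (r i) = (segs ![r, g] 0 i).length := h.numSegments_eq 0
  have h1 : ∀ i, numSegments r g (g i) = (segs ![r, g] 1 i).length := h.numSegments_eq 1
  have h01 : (0 : Fin 2) ≠ 1 := by decide
  obtain ⟨⟨i, l⟩, ⟨hil, hi, hl⟩, hu⟩ := hnd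
  simp only [h0, h1] at hi hl hu
  have hu' : ∀ p q, p ≠ q → (segs ![r, g] 0 p).length = 1 → (segs ![r, g] 1 q).length = 1 →
      p = i ∧ q = l := fun p q hpq hp hq => Prod.ext_iff.1 (hu (p, q) ⟨hpq, hp, hq⟩)
  refine ⟨i, l, hil, fun p => ⟨fun hp => ?_, fun hp => hp ▸ hi⟩,
    fun q => ⟨fun hq => ?_, fun hq => hq ▸ hl⟩⟩
  · exact h.segmentSystem.eq_of_length_eq_one h01 hil hi hl hu' hp
  · exact h.segmentSystem.eq_of_length_eq_one h01.symm hil.symm hl hi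
      (fun p q hpq hp hq => (hu' q p hpq.symm hq hp).symm) hq

end TwoSinkPaths

/-! ### The main theorem -/

theorem mainTheorem4 {V : Type*} (N : PairNetwork 3 V) (hN : N.Stable)
    (a b : Fin 3) (hab : a ≠ b) (r g : Fin 3 → List V)
    (hr : N.IsFamily a r) (hg : N.IsFamily b g) (hnd : NonDegenerated r g) :
    ((ColoredNet.contract r g).suppress.Isomorphic ColoredNet.config111 ∨
      (ColoredNet.contract r g).suppress.Isomorphic ColoredNet.config112 ∨
      (ColoredNet.contract r g).suppress.Isomorphic ColoredNet.config121 ∨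
      (ColoredNet.contract r g).suppress.Isomorphic ColoredNet.config1221 ∨
      (ColoredNet.contract r g).suppress.Isomorphic ColoredNet.config1222) ∧
    ∀ i j l : Fin 3, numSegments r g (r i) = 1 → numSegments r g (g l) = 1 → j ≠ i → j ≠ l →
      (∃ x y, N.IsNthSegment r g (g i) 2 x ∧ N.IsNthSegment r g (r l) 2 y ∧ x ≠ y) ∧
      ((∃! x, IsLCS (g i) (r j) x) ∧ ∃! x, IsLCS (g j) (r l) x) ∧
      ((N.SameSegment r g (g i) 2 (r j) 2 ∧ N.SameSegment r g (g j) 2 (r l) 2) ∨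
        (N.SameSegment r g (g i) 2 (r j) 2 ∧ N.SameSegment r g (g j) 2 (r l) 3) ∨
        (N.SameSegment r g (g i) 3 (r j) 2 ∧ N.SameSegment r g (g j) 2 (r l) 2)) := by
  have h01 : (0 : Fin 2) ≠ 1 := by decide
  have h : TwoSinkPaths N ![a, b] ![r, g] := by
    refine ⟨?_, Fin.forall_fin_two.2 ⟨hr, hg⟩, Fin.forall_fin_two.2
      ⟨fun Q hQ => (hN a).unique hQ hr, fun Q hQ => (hN b).unique hQ hg⟩⟩
    rw [← List.nodup_ofFn]
    simp [hab]
  obtain ⟨i, l, hil, hi, hl⟩ := h.exists_unique_short hnd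
  obtain ⟨j, hji, hjl⟩ := SegmentSystem.exists_third i l
  obtain ⟨si, sj, sl, X, Y, hsi, hsl, hcases⟩ :=
    h.segmentSystem.classification h01 hji.symm hil hjl hi hl
  constructor
  · rcases hcases with ⟨e1, e2, e3, e4⟩ | ⟨Z, e1, e2, e3, e4⟩ | ⟨W, e1, e2, e3, e4⟩ |
      ⟨W, e1, e2, e3, e4⟩ | ⟨W, e1, e2, e3, e4⟩ | ⟨Z, W, e1, e2, e3, e4⟩ | ⟨Z, W, e1, e2, e3, e4⟩
    · exact Or.inl (h.isomorphic_config111 h01 hji.symm hil hjl hsi hsl e1 e2 e3 e4)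
    · exact Or.inr (Or.inl (h.isomorphic_config112 h01 hji.symm hil hjl hsi hsl e1 e2 e3 e4))
    · exact Or.inr (Or.inr (Or.inl
        (h.isomorphic_config121 h01 hji.symm hil hjl hsi hsl e1 e2 e3 e4)))
    · exact Or.inr (Or.inr (Or.inr (Or.inl
        (h.isomorphic_config1221 h01 hji.symm hil hjl hsi hsl e1 e2 e3 e4))))
    -- The mirror image of the preceding case: the colours, the indices `i` and `l`, and the
    -- segments `X` and `Y` change places. The last case below is treated in the same way.
    · exact Or.inr (Or.inr (Or.inr (Or.inl
        (h.isomorphic_config1221 h01.symm hjl.symm hil.symm hji hsl hsi e4 e3 e2 e1))))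
    · exact Or.inr (Or.inr (Or.inr (Or.inr
        (h.isomorphic_config1222 h01 hji.symm hil hjl hsi hsl e1 e2 e3 e4))))
    · exact Or.inr (Or.inr (Or.inr (Or.inr
        (h.isomorphic_config1222 h01.symm hjl.symm hil.symm hji hsl hsi e4 e3 e2 e1))))
  · intro i' j' l' hi' hl' hji' hjl'
    obtain rfl := (hi i').1 ((h.numSegments_eq 0 i').symm.trans hi')
    obtain rfl := (hl l').1 ((h.numSegments_eq 1 l').symm.trans hl')
    obtain rfl : j' = j := by
      rcases SegmentSystem.fin_three_cases hji.symm hil hjl j' with h1 | h1 | h1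
      exacts [(hji' h1).elim, h1, (hjl' h1).elim]
    have ne : ∀ {x y}, x ∈ segs ![r, g] 0 j' → y ∈ segs ![r, g] 0 l' → x ≠ y := by
      rintro x y hx hy rfl
      exact hjl (h.segmentSystem.index hx hy)
    -- Needed where `g_i(2)` is `W` and `r_l(2)` is `Y`: both lie on the same red path, so only
    -- their green paths tell them apart.
    have ne' : ∀ {x y}, x ∈ segs ![r, g] 1 i' → y ∈ segs ![r, g] 1 j' → x ≠ y := by
      rintro x y hx hy rfl
      exact hji (h.segmentSystem.index hx hy).symm
    have nth2 : ∀ {c i s x L}, segs ![r, g] c i = s :: x :: L →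
        N.IsNthSegment r g (![r, g] c i) 2 x := fun {c i s x L} e =>
      h.isNthSegment (L := [s]) e
    have nth3 : ∀ {c i s y x L}, segs ![r, g] c i = s :: y :: x :: L →
        N.IsNthSegment r g (![r, g] c i) 3 x := fun {c i s y x L} e =>
      h.isNthSegment (L := [s, y]) e
    have uniq : ∀ {A B C D}, segs ![r, g] 0 j' = sj :: X :: A → segs ![r, g] 0 l' = sl :: B →
        segs ![r, g] 1 i' = si :: C → segs ![r, g] 1 j' = sj :: Y :: D →
        (∃! x, IsLCS (g i') (r j') x) ∧ ∃! x, IsLCS (g j') (r l') x := by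
      intro A B C D e1 e2 e3 e4
      refine ⟨h.existsUnique_isLCS h01 hji.symm hil hjl hsi hsl e1 e2 e3 e4, ?_⟩
      have := h.existsUnique_isLCS h01.symm hjl.symm hil.symm hji hsl hsi e4 e3 e2 e1
      obtain ⟨x, hx, hu⟩ := this
      exact ⟨x, hx.symm, fun y hy => hu y hy.symm⟩
    rcases hcases with ⟨e1, e2, e3, e4⟩ | ⟨Z, e1, e2, e3, e4⟩ | ⟨W, e1, e2, e3, e4⟩ |
      ⟨W, e1, e2, e3, e4⟩ | ⟨W, e1, e2, e3, e4⟩ | ⟨Z, W, e1, e2, e3, e4⟩ | ⟨Z, W, e1, e2, e3, e4⟩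
    · exact ⟨⟨X, Y, nth2 e3, nth2 e2, ne (by simp [e1]) (by simp [e2])⟩, uniq e1 e2 e3 e4,
        Or.inl ⟨⟨X, nth2 e3, nth2 e1⟩, ⟨Y, nth2 e4, nth2 e2⟩⟩⟩
    · exact ⟨⟨X, Y, nth2 e3, nth2 e2, ne (by simp [e1]) (by simp [e2])⟩, uniq e1 e2 e3 e4,
        Or.inl ⟨⟨X, nth2 e3, nth2 e1⟩, ⟨Y, nth2 e4, nth2 e2⟩⟩⟩
    · exact ⟨⟨X, Y, nth2 e3, nth2 e2, ne (by simp [e1]) (by simp [e2])⟩, uniq e1 e2 e3 e4,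
        Or.inl ⟨⟨X, nth2 e3, nth2 e1⟩, ⟨Y, nth2 e4, nth2 e2⟩⟩⟩
    · exact ⟨⟨X, W, nth2 e3, nth2 e2, ne (by simp [e1]) (by simp [e2])⟩, uniq e1 e2 e3 e4,
        Or.inr (Or.inl ⟨⟨X, nth2 e3, nth2 e1⟩, ⟨Y, nth2 e4, nth3 e2⟩⟩)⟩
    · exact ⟨⟨W, Y, nth2 e3, nth2 e2, ne' (by simp [e3]) (by simp [e4])⟩, uniq e1 e2 e3 e4,
        Or.inr (Or.inr ⟨⟨X, nth3 e3, nth2 e1⟩, ⟨Y, nth2 e4, nth2 e2⟩⟩)⟩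
    · exact ⟨⟨X, W, nth2 e3, nth2 e2, ne (by simp [e1]) (by simp [e2])⟩, uniq e1 e2 e3 e4,
        Or.inr (Or.inl ⟨⟨X, nth2 e3, nth2 e1⟩, ⟨Y, nth2 e4, nth3 e2⟩⟩)⟩
    · exact ⟨⟨W, Y, nth2 e3, nth2 e2, ne' (by simp [e3]) (by simp [e4])⟩, uniq e1 e2 e3 e4,
        Or.inr (Or.inr ⟨⟨X, nth3 e3, nth2 e1⟩, ⟨Y, nth2 e4, nth2 e2⟩⟩)⟩
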